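/- Let $m\ge 2$ and $N\ge 1$ be integers, $h=1/N$. Let $L_2^{(m)}(0,1)$ be the space of functions $\varphi$ on $[0,1]$ with $\varphi^{(m-1)}$ absolutely continuous and $\varphi^{(m)}\in L_2(0,1)$, with $\|\varphi\|=\bigl(\int_0^1(\varphi^{(m)}(x))^2dx\bigr)^{1/2}$. Consider quadrature formulas $$\int_0^1\varphi(x)\,dx\cong\sum_{\beta=0}^N C[\beta]\varphi(h\beta)+A\varphi'(0)+B\varphi'(1)$$ with real coefficients $C[0],\dots,C[N],A,B$, with error $(\ell,\varphi)=\int_0^1\varphi\,dx-\sum_{\beta=0}^N C[\beta]\varphi(h\beta)-A\varphi'(0)-B\varphi'(1)$ and $\|\ell\|=\sup_{\|\varphi\|=1}|(\ell,\varphi)|\in[0,\infty]$. A formula is called optimal in $L_2^{(m)}(0,1)$ if $\|\ell\|<\infty$ and $\|\ell\|$ is the least possible among all choices of $C[\beta],A,B$. Assume that $m\le N+3$, or, more generally, that at least one formula of this form has $\|\ell\|<\infty$. Let $E_k(x)=\frac{(1-x)^{k+2}}{x}\bigl(x\frac{d}{dx}\bigr)^k\frac{x}{(1-x)^2}$ be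 the Euler polynomial of degree $k$, $B_j$ the Bernoulli numbers, and $\Delta^i0^j$ the forward difference of order $i$ with step $1$ of $\gamma\mapsto\gamma^j$ at $\gamma=0$. Then there is exactly one optimal formula. The polynomial $E_{2m-2}$ has exactly $m-1$ distinct complex roots in the open unit disc, and they are real; denote them by $q_1,\dots,q_{m-1}$. The following system of $2m-2$ linear equations in the real unknowns $d_1,\dots,d_{m-1},p_1,\dots,p_{m-1}$ has a solution (a unique one if $m\le N+3$): $$\sum_{k=1}^{m-1}\sum_{i=0}^{j}\frac{d_kq_k+p_kq_k^{N+i}(-1)^{i+1}}{(q_k-1)^{i+1}}\Delta^i0^j=\frac{B_{j+1}}{j+1},\quad j=2,\dots,m-1,$$ $$\sum_{k=1}^{m-1}\sum_{i=0}^{2m-2}\frac{d_kq_k+p_kq_k^{N+i}(-1)^{i+1}}{(q_k-1)^{i+1}}\Delta^i0^{2m-2}=0,$$ $$\sum_{k=1}^{m-1}\sum_{i=0}^{j}(1-q_k^N)\frac{(-1)^{i+1}d_kq_k^i-p_kq_k}{(q_k-1)^{i+1}}\Delta^i0^j=0,\quad j=2,\dots,m-1,$$ $$\sum_{k=1}^{m-1}\sum_{i=0}^{2m-2}\frac{(-1)^{i+1}d_kq_k^{N+i}+p_kq_k}{(q_k-1)^{i+1}}\Delta^i0^{2m-2}=0.$$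 For every solution of this system, the coefficients of the optimal formula are $$C[0]=h\Bigl(\tfrac12+\sum_{k=1}^{m-1}\frac{p_kq_k^N-d_kq_k}{1-q_k}\Bigr),\qquad C[N]=h\Bigl(\tfrac12+\sum_{k=1}^{m-1}\frac{d_kq_k^N-p_kq_k}{1-q_k}\Bigr),$$ $$C[\beta]=h\Bigl(1+\sum_{k=1}^{m-1}\bigl(d_kq_k^\beta+p_kq_k^{N-\beta}\bigr)\Bigr),\quad 1\le\beta\le N-1,$$ $$A=h^2\Bigl(\tfrac1{12}-\sum_{k=1}^{m-1}\frac{d_kq_k+p_kq_k^{N+1}}{(1-q_k)^2}\Bigr),\qquad B=h^2\Bigl(-\tfrac1{12}+\sum_{k=1}^{m-1}\frac{d_kq_k^{N+1}+p_kq_k}{(1-q_k)^2}\Bigr).$$ -/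

import Mathlib

open Set MeasureTheory Polynomial

noncomputable section

namespace OptQuad

/-- `L_2^{(m)}(0,1)`: the functions on `[0,1]` whose derivative of order `m - 1` exists and is
absolutely continuous on `[0,1]` and whose derivative of order `m` (which then exists almost
everywhere) is square integrable. All derivatives are taken within `[0,1]`, so only the values
of `φ` on `[0,1]` matter. -/
structure IsSobolev (m : ℕ) (φ : ℝ → ℝ) : Prop where
  contDiffOn : ContDiffOn ℝ ((m - 1 : ℕ) : WithTop ℕ∞) φ (Icc 0 1)
  absCont : AbsolutelyContinuousOnInterval (iteratedDerivWithin (m - 1) φ (Icc 0 1)) 0 1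
  memLp : MemLp (iteratedDerivWithin m φ (Icc 0 1)) 2 (volume.restrict (Icc 0 1))

/-- The (semi)norm `(∫₀¹ (φ^{(m)}(x))² dx)^{1/2}` of `L_2^{(m)}(0,1)`. -/
def sobolevNorm (m : ℕ) (φ : ℝ → ℝ) : ℝ :=
  Real.sqrt (∫ x in (0 : ℝ)..1, (iteratedDerivWithin m φ (Icc 0 1) x) ^ 2)

/-- The coefficients `C[0], …, C[N]`, `A`, `B` of the quadrature formula
`∫₀¹ φ(x) dx ≅ ∑_{β=0}^N C[β] φ(hβ) + A φ'(0) + B φ'(1)`, `h = 1/N`. -/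
structure Formula (N : ℕ) where
  C : Fin (N + 1) → ℝ
  A : ℝ
  B : ℝ

/-- The error `(ℓ, φ)` of a quadrature formula. -/
def Formula.error {N : ℕ} (Q : Formula N) (φ : ℝ → ℝ) : ℝ :=
  (∫ x in (0 : ℝ)..1, φ x) - ∑ β : Fin (N + 1), Q.C β * φ ((1 / (N : ℝ)) * (β : ℕ))
    - Q.A * derivWithin φ (Icc 0 1) 0 - Q.B * derivWithin φ (Icc 0 1) 1

/-- The norm of the error functional in the conjugate space `L_2^{(m)*}(0,1)`; it is `⊤` when the
error functional is unbounded, that is, does not belong to `L_2^{(m)*}(0,1)`. -/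
def Formula.errorNorm {N : ℕ} (m : ℕ) (Q : Formula N) : ENNReal :=
  ⨆ (φ : ℝ → ℝ) (_ : IsSobolev m φ) (_ : sobolevNorm m φ = 1), ENNReal.ofReal |Q.error φ|

/-- A formula is optimal in `L_2^{(m)}(0,1)` if its error functional belongs to the conjugate space
and has the least norm among all formulas with the same nodes. -/
def Formula.IsOptimal {N : ℕ} (m : ℕ) (Q : Formula N) : Prop :=
  Q.errorNorm m ≠ ⊤ ∧ ∀ Q' : Formula N, Q.errorNorm m ≤ Q'.errorNorm m

/-- The Euler polynomials (also called Euler–Frobenius polynomials)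
`E_k(x) = (1-x)^{k+2}/x · (x d/dx)^k (x/(1-x)²)`, as polynomials; see `eval_eulerPoly`. -/
def eulerPoly : ℕ → ℝ[X]
  | 0 => 1
  | k + 1 => (1 + ((k : ℝ[X]) + 1) * X) * eulerPoly k + X * (1 - X) * derivative (eulerPoly k)

theorem iterate_eulerOp (k : ℕ) : ∀ x : ℝ, x ≠ 1 →
    (fun (f : ℝ → ℝ) (y : ℝ) => y * deriv f y)^[k] (fun y => y / (1 - y) ^ 2) x
      = x * (eulerPoly k).eval x / (1 - x) ^ (k + 2) := by
  induction k with
  | zero => intro x _; simp [eulerPoly]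
  | succ k ih =>
    intro x hx
    rw [Function.iterate_succ_apply']
    have h1 : (1 - x) ≠ 0 := sub_ne_zero.mpr (Ne.symm hx)
    have hev : (fun (f : ℝ → ℝ) (y : ℝ) => y * deriv f y)^[k] (fun y => y / (1 - y) ^ 2)
        =ᶠ[nhds x] fun y => y * (eulerPoly k).eval y / (1 - y) ^ (k + 2) := by
      filter_upwards [isOpen_ne.mem_nhds hx] with y hy using ih y hy
    have hd : HasDerivAt (fun y : ℝ => y * (eulerPoly k).eval y / (1 - y) ^ (k + 2)) _ x :=
      (((hasDerivAt_id x).mul ((eulerPoly k).hasDerivAt x)).div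
        (((hasDerivAt_id x).const_sub 1).pow (k + 2)) (pow_ne_zero _ h1))
    simp only [hev.deriv_eq, hd.deriv]
    simp only [eulerPoly, eval_add, eval_mul, eval_sub, eval_one, eval_X, eval_natCast,
      id_eq, Nat.cast_add, Nat.cast_ofNat, Pi.mul_apply]
    simp only [show k + 2 - 1 = k + 1 from rfl]
    field_simp
    ring

theorem eval_eulerPoly (k : ℕ) (x : ℝ) (h0 : x ≠ 0) (h1 : x ≠ 1) :
    (eulerPoly k).eval x = (1 - x) ^ (k + 2) / x *
      (fun (f : ℝ → ℝ) (y : ℝ) => y * deriv f y)^[k] (fun y => y / (1 - y) ^ 2) x := by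
  have : (1 - x) ≠ 0 := sub_ne_zero.mpr (Ne.symm h1)
  rw [iterate_eulerOp k x h1]
  field_simp

/-- `q_1, …, q_{m-1}` are, without repetition, all the complex roots of `E_{2m-2}` in the open unit
disc (all of them real). -/
def IsInnerRoots (m : ℕ) (q : Fin (m - 1) → ℝ) : Prop :=
  Function.Injective q ∧
    ∀ z : ℂ, (aeval z (eulerPoly (2 * m - 2)) = 0 ∧ ‖z‖ < 1) ↔ ∃ k, (q k : ℂ) = z

/-- `Δ^i 0^j`, the forward difference of order `i` with step `1` of `γ ↦ γ^j` at `γ = 0`. -/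
def diffZero (i j : ℕ) : ℝ := (fwdDiff (1 : ℝ))^[i] (fun γ : ℝ => γ ^ j) 0

/-- The system of `2m - 2` linear equations for `d_k`, `p_k`, `1 ≤ k ≤ m - 1`. -/
structure IsSolution (m N : ℕ) (q d p : Fin (m - 1) → ℝ) : Prop where
  left_low : ∀ j : ℕ, 2 ≤ j → j ≤ m - 1 →
    ∑ k, ∑ i ∈ Finset.range (j + 1),
      (d k * q k + p k * q k ^ (N + i) * (-1) ^ (i + 1)) / (q k - 1) ^ (i + 1) * diffZero i j
      = (bernoulli (j + 1) : ℝ) / ((j : ℝ) + 1)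
  left_top :
    ∑ k, ∑ i ∈ Finset.range (2 * m - 2 + 1),
      (d k * q k + p k * q k ^ (N + i) * (-1) ^ (i + 1)) / (q k - 1) ^ (i + 1)
        * diffZero i (2 * m - 2) = 0
  right_low : ∀ j : ℕ, 2 ≤ j → j ≤ m - 1 →
    ∑ k, ∑ i ∈ Finset.range (j + 1),
      (1 - q k ^ N) * (((-1) ^ (i + 1) * d k * q k ^ i - p k * q k) / (q k - 1) ^ (i + 1))
        * diffZero i j = 0
  right_top :
    ∑ k, ∑ i ∈ Finset.range (2 * m - 2 + 1),
      ((-1) ^ (i + 1) * d k * q k ^ (N + i) + p k * q k) / (q k - 1) ^ (i + 1)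
        * diffZero i (2 * m - 2) = 0

/-- The formula with the explicit coefficients determined by `q_k`, `d_k`, `p_k`. -/
def explicitFormula (m N : ℕ) (q d p : Fin (m - 1) → ℝ) : Formula N where
  C := fun β =>
    if (β : ℕ) = 0 then
      (1 / (N : ℝ)) * (1 / 2 + ∑ k, (p k * q k ^ N - d k * q k) / (1 - q k))
    else if (β : ℕ) = N then
      (1 / (N : ℝ)) * (1 / 2 + ∑ k, (d k * q k ^ N - p k * q k) / (1 - q k))
    else
      (1 / (N : ℝ)) * (1 + ∑ k, (d k * q k ^ (β : ℕ) + p k * q k ^ (N - (β : ℕ))))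
  A := (1 / (N : ℝ)) ^ 2 *
    (1 / 12 - ∑ k, (d k * q k + p k * q k ^ (N + 1)) / (1 - q k) ^ 2)
  B := (1 / (N : ℝ)) ^ 2 *
    (-(1 / 12) + ∑ k, (d k * q k ^ (N + 1) + p k * q k) / (1 - q k) ^ 2)

end OptQuad

end

/-!
Let `h = 1 / N`. A formula `Q` is optimal as soon as its error is represented by a function `ψ`,
in the sense that `Q.error φ = (-1) ^ m ∫₀¹ ψ^(m) φ^(m)` for all `φ`, where `ψ` vanishes at all
nodes and `ψ'` vanishes at both end points. Indeed every formula then has the same error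
`∫₀¹ ψ = ± ‖ψ‖²` at `ψ`, so that no error norm is smaller than `‖ψ‖`, whereas the norm of the error
of `Q` is `‖ψ‖` by the Cauchy–Schwarz inequality. Equality in the norm estimate along the lines
`ψ + t p` shows that an optimal formula has the same error as `Q` on every polynomial `p`, hence the
same coefficients (`Formula.isOptimal_of_representer`).

Such a `ψ` is a piecewise polynomial of degree `2m` with `ψ^(2m) = 1` between the nodes. It is the
sum of the periodic Bernoulli monospline and a spline of degree `2m - 1` that vanishes at the nodes.
The latter is a combination of exponential Euler splines, which satisfy `s (x + h) = r s x`, where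
`r` is a zero of `E_{2m-2}`: one of the `q_k` (weight `p_k q_k^N`, growing towards the right end) or
one of their inverses (weight `d_k`). The Taylor coefficients of an exponential Euler spline at a
knot are the sums `∑_γ γ^n r^γ`, continued analytically in `r` (`powerSum`). In the variable
`u = 1 / (1 - r)` they are polynomials (`geomPoly`) with simple recursions: Rolle's theorem and the
symmetry `u ↦ 1 - u` give the distribution of the zeros, and expanding in powers of `u - 1` gives
the finite differences `Δ^i 0^j`.

Integration by parts over the pieces (`IsInnerRoots.green`) shows that `ψ` represents the error of
the formula with the explicit coefficients as soon as the derivatives of orders `m, …, 2m - 3`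
of `ψ` vanish at both end points; together with `ψ' = 0` there, this is the linear system
(`IsInnerRoots.isSolution_iff`).

The system is square, and solvability follows from the Fredholm alternative
(`IsInnerRoots.exists_solution`). A linear functional that annihilates its range is represented by
a null spline of zero energy, that is, by a polynomial `P` of degree less than `m` that vanishes at
the nodes and whose derivative vanishes at the end points; its value on the right-hand side is
`± ∫₀¹ P`. If some formula has a bounded error, it is exact on `P`, so this integral is zero; if
`m ≤ N + 3`, then `P = 0` by Rolle's theorem, which also gives uniqueness of the solution.
-/

noncomputable section

namespace OptQuad

/-! ### Power sums -/

section

/-- The polynomial `G_l` in `u = 1 / (1 - r)` with `∑_{γ ≥ 0} γ^l r^γ = G_l(u)` for `|r| < 1`.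
In the variable `u` the operator `r d/dr` is `u (u - 1) d/du`. -/
def geomPoly : ℕ → ℝ[X]
  | 0 => X
  | l + 1 => X * (X - 1) * derivative (geomPoly l)

/-- The sum `∑_{γ ≥ 0} γ^l r^γ`, continued analytically to all `r ≠ 1`. -/
def powerSum (l : ℕ) (r : ℝ) : ℝ := (geomPoly l).eval (1 / (1 - r))

theorem geomPoly_one_comp_one_sub : (geomPoly 1).comp (1 - X) = geomPoly 1 := by
  simp [geomPoly]; ring

/-- The reflection `u ↦ 1 - u` is the inversion `r ↦ 1 / r`. -/
theorem geomPoly_comp_one_sub (l : ℕ) :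
    (geomPoly (l + 1)).comp (1 - X) = (-1) ^ l * geomPoly (l + 1) := by
  induction l with
  | zero => simp [geomPoly_one_comp_one_sub]
  | succ l ih =>
    have h := congrArg derivative ih
    rw [derivative_comp] at h
    have h1 : derivative ((-1 : ℝ[X]) ^ l * geomPoly (l + 1))
        = (-1) ^ l * derivative (geomPoly (l + 1)) := by
      have : ((-1 : ℝ[X]) ^ l) = C ((-1) ^ l) := by simp
      rw [this, derivative_C_mul]
    rw [h1] at h
    simp only [derivative_sub, derivative_one, derivative_X, zero_sub] at h
    rw [geomPoly, mul_comp, mul_comp, X_comp, sub_comp, X_comp, one_comp, pow_succ]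
    linear_combination (X * (1 - X)) * h

theorem eval_zero_geomPoly (l : ℕ) : (geomPoly l).eval 0 = 0 := by
  cases l <;> simp [geomPoly]

theorem eval_one_geomPoly (l : ℕ) : (geomPoly (l + 1)).eval 1 = 0 := by
  simp [geomPoly]

theorem natDegree_geomPoly_le (l : ℕ) : (geomPoly l).natDegree ≤ l + 1 := by
  induction l with
  | zero => simp [geomPoly]
  | succ l ih =>
    rw [geomPoly]
    have h1 : (derivative (geomPoly l)).natDegree ≤ l :=
      (natDegree_derivative_le _).trans (by omega)
    have h2 : (X * (X - 1) : ℝ[X]).natDegree ≤ 2 := by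
      have : (X * (X - 1) : ℝ[X]) = X * (X - C 1) := by simp
      rw [this]; compute_degree
    exact natDegree_mul_le.trans (by omega)

theorem coeff_geomPoly (l : ℕ) : (geomPoly l).coeff (l + 1) = l.factorial := by
  induction l with
  | zero => simp [geomPoly]
  | succ l ih =>
    have : geomPoly (l + 1) = X * (X * derivative (geomPoly l)) - X * derivative (geomPoly l) := by
      rw [geomPoly]; ring
    rw [this, coeff_sub, coeff_X_mul, coeff_X_mul, coeff_X_mul, coeff_derivative, coeff_derivative,
      ih, coeff_eq_zero_of_natDegree_lt (lt_of_le_of_lt (natDegree_geomPoly_le l) (by omega))]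
    push_cast [Nat.factorial_succ]
    ring

theorem geomPoly_ne_zero (l : ℕ) : geomPoly l ≠ 0 := by
  intro h
  have := coeff_geomPoly l
  rw [h, coeff_zero] at this
  exact (Nat.cast_ne_zero.mpr l.factorial_ne_zero) this.symm

/-- Pascal's rule for binomial transforms. -/
theorem sum_choose_succ {M : Type*} [AddCommMonoid M] (a : ℕ → M) (n : ℕ) :
    ∑ l ∈ Finset.range (n + 2), (n + 1).choose l • a l
      = ∑ l ∈ Finset.range (n + 1), n.choose l • a l
        + ∑ l ∈ Finset.range (n + 1), n.choose l • a (l + 1) := by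
  rw [Finset.sum_range_succ']
  simp only [Nat.choose_succ_succ, add_smul, Finset.sum_add_distrib]
  have : ∑ l ∈ Finset.range (n + 1), n.choose l • a l
      = ∑ l ∈ Finset.range (n + 1), n.choose (l + 1) • a (l + 1) + n.choose 0 • a 0 := by
    rw [← Finset.sum_range_succ' (fun l => n.choose l • a l), Finset.sum_range_succ _ (n + 1)]
    simp
  rw [this]
  simp only [Nat.choose_zero_right]
  abel

/-- Shifting the summation index by one in `∑_γ γ^n r^γ`. -/
theorem geomPoly_shift (n : ℕ) :
    (X - 1) * ∑ l ∈ Finset.range (n + 1), n.choose l • geomPoly l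
      = X * geomPoly n - if n = 0 then X else 0 := by
  induction n with
  | zero => simp [geomPoly]; ring
  | succ n ih =>
    rw [sum_choose_succ]
    have hD : ∑ l ∈ Finset.range (n + 1), n.choose l • geomPoly (l + 1)
        = X * (X - 1) * derivative (∑ l ∈ Finset.range (n + 1), n.choose l • geomPoly l) := by
      rw [derivative_sum, Finset.mul_sum]
      refine Finset.sum_congr rfl fun l _ => ?_
      simp only [geomPoly, nsmul_eq_mul, derivative_natCast_mul]
      ring
    rw [hD]
    set A := ∑ l ∈ Finset.range (n + 1), n.choose l • geomPoly l
    have h := congrArg derivative ih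
    simp only [derivative_mul, derivative_sub, derivative_X, derivative_one] at h
    rw [if_neg (Nat.succ_ne_zero n), geomPoly]
    rcases Nat.eq_zero_or_pos n with rfl | hn
    · simp [geomPoly] at h ih ⊢
      linear_combination X * (X - 1) * h + (1 - X) * ih
    · rw [if_neg hn.ne'] at h ih
      simp only [derivative_zero] at h
      linear_combination X * (X - 1) * h + (1 - X) * ih

theorem powerSum_shift (n : ℕ) {r : ℝ} (hr : r ≠ 1) :
    r * ∑ l ∈ Finset.range (n + 1), (n.choose l : ℝ) * powerSum l r
      = powerSum n r - if n = 0 then 1 else 0 := by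
  have h1 : (1 - r) ≠ 0 := sub_ne_zero.mpr (Ne.symm hr)
  have h := congrArg (eval (1 / (1 - r))) (geomPoly_shift n)
  simp only [eval_mul, eval_sub, eval_X, eval_one, eval_finsetSum, nsmul_eq_mul, eval_natCast,
    apply_ite (eval (1 / (1 - r))), eval_zero] at h
  change _ * ∑ l ∈ Finset.range (n + 1), (n.choose l : ℝ) * powerSum l r
    = _ * powerSum n r - _ at h
  generalize (∑ l ∈ Finset.range (n + 1), (n.choose l : ℝ) * powerSum l r) = T at h ⊢
  have h2 : (1 - r) * ((1 / (1 - r) - 1) * T) = r * T := by field_simp; ring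
  rw [← h2, h]
  split_ifs
  · field_simp
  · field_simp
    ring

theorem powerSum_zero (r : ℝ) : powerSum 0 r = 1 / (1 - r) := by simp [powerSum, geomPoly]

theorem powerSum_one {r : ℝ} (hr : r ≠ 1) : powerSum 1 r = r / (1 - r) ^ 2 := by
  have h1 : (1 - r) ≠ 0 := sub_ne_zero.mpr (Ne.symm hr)
  simp [powerSum, geomPoly]
  field_simp
  ring

theorem powerSum_inv (l : ℕ) {r : ℝ} (h0 : r ≠ 0) (h1 : r ≠ 1) :
    powerSum (l + 1) r⁻¹ = (-1) ^ l * powerSum (l + 1) r := by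
  have h1 : (1 - r) ≠ 0 := sub_ne_zero.mpr (Ne.symm h1)
  have h2 : (1 - r⁻¹) ≠ 0 := by
    intro h; apply h1; field_simp at h; linarith
  have h := congrArg (eval (1 / (1 - r))) (geomPoly_comp_one_sub l)
  have h3 : (1 / (1 - r⁻¹)) = 1 - 1 / (1 - r) := by
    have : r - 1 ≠ 0 := by intro h; apply h1; linarith
    field_simp; ring
  simp only [eval_comp, eval_sub, eval_one, eval_X, eval_mul, eval_pow, eval_neg] at h
  rw [powerSum, h3, h, powerSum]

theorem fwdDiff_iter_mul_id (f : ℝ → ℝ) (i : ℕ) (y : ℝ) :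
    (fwdDiff (1 : ℝ))^[i] (fun x => x * f x) y
      = y * (fwdDiff (1 : ℝ))^[i] f y + i * (fwdDiff (1 : ℝ))^[i - 1] f (y + 1) := by
  induction i generalizing y with
  | zero => simp
  | succ i ih =>
    rw [Function.iterate_succ_apply', fwdDiff, ih, ih]
    rcases Nat.eq_zero_or_pos i with rfl | hi
    · simp [fwdDiff]; ring
    · obtain ⟨k, rfl⟩ : ∃ k, i = k + 1 := ⟨i - 1, by omega⟩
      simp only [Nat.add_sub_cancel]
      have e1 := congrFun (Function.iterate_succ_apply' (fwdDiff (1 : ℝ)) (k + 1) f) y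
      have e2 := congrFun (Function.iterate_succ_apply' (fwdDiff (1 : ℝ)) k f) (y + 1)
      rw [fwdDiff] at e1 e2
      rw [e1, e2]
      push_cast
      ring

theorem diffZero_succ (i j : ℕ) :
    diffZero (i + 1) (j + 1) = (i + 1) * (diffZero (i + 1) j + diffZero i j) := by
  have h := fwdDiff_iter_mul_id (fun γ => γ ^ j) (i + 1) 0
  have h2 := congrFun (Function.iterate_succ_apply' (fwdDiff (1 : ℝ)) i (fun γ => γ ^ j)) 0
  rw [fwdDiff] at h2
  simp only [diffZero]
  have e : (fun γ : ℝ => γ ^ (j + 1)) = fun x => x * x ^ j := by funext x; ring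
  rw [e, h, h2]
  simp

theorem diffZero_zero_succ (j : ℕ) : diffZero 0 (j + 1) = 0 := by simp [diffZero]

theorem diffZero_of_lt {i j : ℕ} (h : j < i) : diffZero i j = 0 := by
  have := congrFun (fwdDiff_iter_pow_eq_zero_of_lt (R := ℝ) h) 0
  simpa [diffZero] using this

/-- The classical expansion `∑_γ γ^j r^γ = ∑_i Δ^i 0^j r^i / (1 - r)^{i+1}`. -/
theorem geomPoly_eq_sum (j : ℕ) :
    geomPoly j = ∑ i ∈ Finset.range (j + 1), C (diffZero i j) * (X * (X - 1) ^ i) := by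
  induction j with
  | zero => simp [geomPoly, diffZero]
  | succ j ih =>
    have hstep : ∀ i : ℕ, X * (X - 1) * derivative (X * (X - 1) ^ i : ℝ[X])
        = (i + 1 : ℝ[X]) * (X * (X - 1) ^ (i + 1)) + (i : ℝ[X]) * (X * (X - 1) ^ i) := by
      intro i
      rcases i with _ | i
      · simp
      · simp only [derivative_mul, derivative_X, derivative_pow, derivative_sub, derivative_one,
          Nat.add_sub_cancel, C_eq_natCast]
        push_cast
        ring
    rw [geomPoly, ih, derivative_sum, Finset.mul_sum]
    have : ∀ i, X * (X - 1) * derivative (C (diffZero i j) * (X * (X - 1) ^ i) : ℝ[X])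
        = (i + 1 : ℝ[X]) * C (diffZero i j) * (X * (X - 1) ^ (i + 1))
          + (i : ℝ[X]) * C (diffZero i j) * (X * (X - 1) ^ i) := by
      intro i
      rw [derivative_C_mul]
      linear_combination C (diffZero i j) * hstep i
    rw [Finset.sum_congr rfl fun i _ => this i, Finset.sum_add_distrib,
      Finset.sum_range_succ' _ (j + 1), diffZero_zero_succ]
    have e2 : ∑ i ∈ Finset.range (j + 1), (i : ℝ[X]) * C (diffZero i j) * (X * (X - 1) ^ i)
        = ∑ i ∈ Finset.range (j + 1),
          ((i + 1 : ℕ) : ℝ[X]) * C (diffZero (i + 1) j) * (X * (X - 1) ^ (i + 1)) := by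
      have h := Finset.sum_range_succ'
        (fun i : ℕ => (i : ℝ[X]) * C (diffZero i j) * (X * (X - 1) ^ i)) (j + 1)
      rw [Finset.sum_range_succ, diffZero_of_lt (Nat.lt_succ_self j)] at h
      simpa using h
    rw [e2, ← Finset.sum_add_distrib]
    simp only [C_0, zero_mul, add_zero]
    refine Finset.sum_congr rfl fun i _ => ?_
    rw [diffZero_succ]
    simp only [C_mul, C_add, C_eq_natCast, C_1]
    push_cast
    ring

theorem powerSum_eq_sum (j : ℕ) {r : ℝ} (hr : r ≠ 1) :
    powerSum j r = ∑ i ∈ Finset.range (j + 1), diffZero i j * ((-1) ^ (i + 1) * r ^ i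
      / (r - 1) ^ (i + 1)) := by
  have h1 : (1 - r) ≠ 0 := sub_ne_zero.mpr (Ne.symm hr)
  have h2 : (r - 1) ≠ 0 := sub_ne_zero.mpr hr
  rw [powerSum, geomPoly_eq_sum, eval_finsetSum]
  refine Finset.sum_congr rfl fun i _ => ?_
  simp only [eval_mul, eval_C, eval_X, eval_pow, eval_sub, eval_one]
  have e : 1 / (1 - r) - 1 = (-r) / (r - 1) := by field_simp; ring
  have e' : 1 / (1 - r) = (-1) / (r - 1) := by field_simp; ring
  rw [e, e', div_pow, neg_pow, pow_succ (-1 : ℝ), pow_succ (r - 1)]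
  field_simp

theorem powerSum_inv_eq_sum (j : ℕ) {r : ℝ} (h0 : r ≠ 0) (hr : r ≠ 1) :
    powerSum j r⁻¹ = ∑ i ∈ Finset.range (j + 1), diffZero i j * (r / (r - 1) ^ (i + 1)) := by
  have h1 : (1 - r) ≠ 0 := sub_ne_zero.mpr (Ne.symm hr)
  have h2 : (r - 1) ≠ 0 := sub_ne_zero.mpr hr
  rw [powerSum, geomPoly_eq_sum, eval_finsetSum]
  refine Finset.sum_congr rfl fun i _ => ?_
  simp only [eval_mul, eval_C, eval_X, eval_pow, eval_sub, eval_one]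
  have e' : 1 / (1 - r⁻¹) = r / (r - 1) := by
    rw [show 1 - r⁻¹ = (r - 1) / r by field_simp, one_div_div]
  have e : r / (r - 1) - 1 = 1 / (r - 1) := by field_simp; ring
  rw [e', e, div_pow, one_pow, pow_succ (r - 1)]
  field_simp

end

/-! ### Zeros of the Euler polynomials -/

section

theorem hasDerivAt_powerSum (l : ℕ) {x : ℝ} (hx : x ≠ 1) :
    HasDerivAt (powerSum l) ((derivative (geomPoly l)).eval (1 / (1 - x)) * (1 / (1 - x) ^ 2)) x := by
  have h1 : (1 - x) ≠ 0 := sub_ne_zero.mpr (Ne.symm hx)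
  have h := ((geomPoly l).hasDerivAt (1 / (1 - x))).comp x
    ((((hasDerivAt_id x).const_sub 1)).fun_inv h1 |>.congr_of_eventuallyEq
      (f₁ := fun y => 1 / (1 - y)) (by filter_upwards with y; simp))
  exact h.congr_deriv (by simp)

/-- The Euler polynomials are the numerators of the sums `∑_γ γ^{k+1} x^γ`. -/
theorem powerSum_succ_eq_eulerPoly (k : ℕ) {x : ℝ} (hx : x ≠ 1) :
    powerSum (k + 1) x = x * (eulerPoly k).eval x / (1 - x) ^ (k + 2) := by
  rw [← iterate_eulerOp k x hx]
  induction k generalizing x with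
  | zero => simpa using powerSum_one hx
  | succ k ih =>
    have h1 : (1 - x) ≠ 0 := sub_ne_zero.mpr (Ne.symm hx)
    rw [Function.iterate_succ_apply']
    have hev : (fun (f : ℝ → ℝ) (y : ℝ) => y * deriv f y)^[k] (fun y => y / (1 - y) ^ 2)
        =ᶠ[nhds x] powerSum (k + 1) := by
      filter_upwards [isOpen_ne.mem_nhds hx] with y hy using (ih hy).symm
    simp only [hev.deriv_eq, (hasDerivAt_powerSum (k + 1) hx).deriv]
    rw [powerSum, geomPoly]
    simp only [eval_mul, eval_sub, eval_X, eval_one]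
    field_simp
    ring

theorem eulerPoly_eval_zero (k : ℕ) : (eulerPoly k).eval 0 = 1 := by
  induction k with
  | zero => simp [eulerPoly]
  | succ k ih => simp [eulerPoly, ih]

theorem eulerPoly_eval_one_pos (k : ℕ) : 0 < (eulerPoly k).eval 1 := by
  induction k with
  | zero => simp [eulerPoly]
  | succ k ih =>
    simp only [eulerPoly, eval_add, eval_mul, eval_sub, eval_one, eval_X, eval_natCast]
    have : 0 < (1 + ((k : ℝ) + 1) * 1) * (eulerPoly k).eval 1 := by positivity
    simpa using this

theorem eulerPoly_ne_zero (k : ℕ) : eulerPoly k ≠ 0 := by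
  intro h
  have := eulerPoly_eval_zero k
  rw [h, eval_zero] at this
  exact zero_ne_one this

theorem natDegree_eulerPoly_le (k : ℕ) : (eulerPoly k).natDegree ≤ k := by
  induction k with
  | zero => simp [eulerPoly]
  | succ k ih =>
    rcases Nat.eq_zero_or_pos k with rfl | hk
    · have : eulerPoly 1 = 1 + X := by simp [eulerPoly]
      rw [this, show (1 + X : ℝ[X]) = X + C 1 by simp [add_comm]]
      exact (natDegree_X_add_C _).le
    rw [eulerPoly]
    have h1 : (derivative (eulerPoly k)).natDegree ≤ k - 1 :=
      (natDegree_derivative_le _).trans (by omega)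
    have h2 : (X * (1 - X) : ℝ[X]).natDegree ≤ 2 := by
      have : (X * (1 - X) : ℝ[X]) = X * (C 1 - X) := by simp
      rw [this]; compute_degree
    have h3 : (1 + ((k : ℝ[X]) + 1) * X).natDegree ≤ 1 := by
      have : (1 + ((k : ℝ[X]) + 1) * X) = C 1 + C ((k : ℝ) + 1) * X := by simp
      rw [this]; compute_degree
    refine (natDegree_add_le _ _).trans (max_le ?_ ?_)
    · exact natDegree_mul_le.trans (by omega)
    · exact natDegree_mul_le.trans (by omega)

/-- By Rolle's theorem `G_l` has `l + 1` distinct real zeros. -/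
theorem card_roots_geomPoly (l : ℕ) : (geomPoly l).roots.toFinset.card = l + 1 := by
  have hle : ∀ l, (geomPoly l).roots.toFinset.card ≤ l + 1 := fun l =>
    (Multiset.toFinset_card_le _).trans ((card_roots' _).trans (natDegree_geomPoly_le l))
  refine le_antisymm (hle l) ?_
  induction l with
  | zero => simp [geomPoly]
  | succ l ih =>
    rcases Nat.eq_zero_or_pos l with rfl | hl
    · have : ({0, 1} : Finset ℝ) ⊆ (geomPoly 1).roots.toFinset := by
        intro x hx
        rw [Multiset.mem_toFinset, mem_roots (geomPoly_ne_zero 1), IsRoot.def]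
        simp only [Finset.mem_insert, Finset.mem_singleton] at hx
        rcases hx with rfl | rfl
        · exact eval_zero_geomPoly 1
        · exact eval_one_geomPoly 0
      simpa using Finset.card_le_card this
    obtain ⟨k, rfl⟩ : ∃ k, l = k + 1 := ⟨l - 1, by omega⟩
    have hR := card_roots_toFinset_le_card_roots_derivative_sdiff_roots_succ (geomPoly (k + 1))
    set D := (derivative (geomPoly (k + 1))).roots.toFinset \ (geomPoly (k + 1)).roots.toFinset
    have hsub : insert 0 (insert 1 D) ⊆ (geomPoly (k + 2)).roots.toFinset := by
      intro x hx
      rw [Multiset.mem_toFinset, mem_roots (geomPoly_ne_zero _), IsRoot.def]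
      simp only [Finset.mem_insert] at hx
      rcases hx with rfl | rfl | hx
      · exact eval_zero_geomPoly _
      · exact eval_one_geomPoly _
      · have := (Multiset.mem_toFinset.mp (Finset.mem_sdiff.mp hx).1)
        have := isRoot_of_mem_roots this
        rw [geomPoly, eval_mul, IsRoot.def.mp this, mul_zero]
    have hmem : ∀ y : ℝ, (geomPoly (k + 1)).eval y = 0 → y ∉ D := by
      intro y hy hD
      exact (Finset.mem_sdiff.mp hD).2
        (Multiset.mem_toFinset.mpr ((mem_roots (geomPoly_ne_zero _)).mpr hy))
    have hc := Finset.card_le_card hsub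
    rw [Finset.card_insert_of_notMem, Finset.card_insert_of_notMem] at hc
    · change k + 1 + 1 + 1 ≤ (geomPoly (k + 2)).roots.toFinset.card
      omega
    · exact hmem 1 (eval_one_geomPoly _)
    · simp only [Finset.mem_insert, not_or]
      exact ⟨zero_ne_one, hmem 0 (eval_zero_geomPoly _)⟩

/-- The zeros of `G_{2n+1}` are symmetric about `1/2`, so exactly half of the `2n + 2` zeros
exceed `1/2`. -/
theorem card_roots_geomPoly_gt_half (n : ℕ) :
    ((geomPoly (2 * n + 1)).roots.toFinset.filter (fun u => 1 / 2 < u)).card = n + 1 := by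
  set R := (geomPoly (2 * n + 1)).roots.toFinset with hRdef
  have hmem : ∀ u, u ∈ R ↔ (geomPoly (2 * n + 1)).eval u = 0 := by
    intro u
    rw [hRdef, Multiset.mem_toFinset, mem_roots (geomPoly_ne_zero _), IsRoot.def]
  have hsymm : ∀ u, u ∈ R → 1 - u ∈ R := by
    intro u hu
    rw [hmem] at hu ⊢
    have h := congrArg (eval u) (geomPoly_comp_one_sub (2 * n))
    simpa [eval_comp, hu] using h
  have hbij : (R.filter (fun u => u < 1 / 2)).card = (R.filter (fun u => 1 / 2 < u)).card := by
    refine Finset.card_bij (fun u _ => 1 - u) ?_ ?_ ?_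
    · intro u hu
      rw [Finset.mem_filter] at hu ⊢
      exact ⟨hsymm u hu.1, by linarith [hu.2]⟩
    · intro a _ b _ h
      simpa using h
    · intro u hu
      rw [Finset.mem_filter] at hu
      exact ⟨1 - u, Finset.mem_filter.mpr ⟨hsymm u hu.1, by linarith [hu.2]⟩, by ring⟩
  have hcard : R.card = 2 * n + 2 := card_roots_geomPoly _
  have h1 := Finset.card_filter_add_card_filter_not (s := R) (fun u => 1 / 2 < u)
  have h2 := Finset.card_filter_add_card_filter_not
    (s := R.filter (fun u => ¬ 1 / 2 < u)) (fun u => u < 1 / 2)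
  have h3 : (R.filter (fun u => ¬ 1 / 2 < u)).filter (fun u => u < 1 / 2)
      = R.filter (fun u => u < 1 / 2) := by
    ext u; simp only [Finset.mem_filter, not_lt]
    exact ⟨fun h => ⟨h.1.1, h.2⟩, fun h => ⟨⟨h.1, h.2.le⟩, h.2⟩⟩
  have h4 : ((R.filter (fun u => ¬ 1 / 2 < u)).filter (fun u => ¬ u < 1 / 2)).card ≤ 1 := by
    rw [Finset.card_le_one]
    intro a ha b hb
    simp only [Finset.mem_filter, not_lt] at ha hb
    linarith [ha.1.2, ha.2, hb.1.2, hb.2]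
  rw [h3] at h2
  omega

theorem eulerPoly_eval_eq_zero_iff (k : ℕ) {x : ℝ} (h0 : x ≠ 0) (h1 : x ≠ 1) :
    (eulerPoly k).eval x = 0 ↔ powerSum (k + 1) x = 0 := by
  have : (1 - x) ≠ 0 := sub_ne_zero.mpr (Ne.symm h1)
  rw [powerSum_succ_eq_eulerPoly k h1]
  simp [h0, this]

/-- All complex zeros of `E_k` are real, because `E_k` has `k` distinct real zeros. -/
theorem eulerPoly_complex_root (k : ℕ) {z : ℂ} (hz : aeval z (eulerPoly k) = 0) :
    ∃ x : ℝ, (x : ℂ) = z ∧ (eulerPoly k).eval x = 0 := by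
  have hcard : k ≤ (eulerPoly k).roots.toFinset.card := by
    have h := card_roots_geomPoly (k + 1)
    set R := (geomPoly (k + 1)).roots.toFinset with hR
    have hmem : ∀ u, u ∈ R ↔ (geomPoly (k + 1)).eval u = 0 := by
      intro u
      rw [hR, Multiset.mem_toFinset, mem_roots (geomPoly_ne_zero _), IsRoot.def]
    have h2 : k ≤ ((R.erase 0).erase 1).card := by
      have e1 := Finset.pred_card_le_card_erase (s := R) (a := 0)
      have e2 := Finset.pred_card_le_card_erase (s := R.erase 0) (a := 1)
      omega
    refine h2.trans (Finset.card_le_card_of_injOn (fun u => 1 - 1 / u) ?_ ?_)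
    · intro u hu
      simp only [Finset.coe_erase, Set.mem_sdiff, Set.mem_singleton_iff, Finset.mem_coe] at hu
      obtain ⟨⟨huR, hu0⟩, hu1⟩ := hu
      simp only [Finset.mem_coe]
      rw [Multiset.mem_toFinset, mem_roots (eulerPoly_ne_zero _), IsRoot.def,
        eulerPoly_eval_eq_zero_iff, powerSum]
      · rw [hmem] at huR
        simpa using huR
      · intro h
        apply hu1
        field_simp at h
        linarith
      · simpa using hu0
    · intro a _ b _ h
      simpa using h
  have hdeg := natDegree_eulerPoly_le k
  have hc : (eulerPoly k).roots.card = (eulerPoly k).natDegree :=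
    le_antisymm (card_roots' _)
      (hdeg.trans (hcard.trans (Multiset.toFinset_card_le _)))
  have hmap := roots_map_of_injective_of_card_eq_natDegree
    (f := algebraMap ℝ ℂ) (algebraMap ℝ ℂ).injective hc
  have hzm : z ∈ ((eulerPoly k).map (algebraMap ℝ ℂ)).roots := by
    rw [mem_roots ((Polynomial.map_ne_zero_iff (algebraMap ℝ ℂ).injective).mpr
      (eulerPoly_ne_zero k)), IsRoot.def, eval_map_algebraMap]
    exact hz
  rw [← hmap, Multiset.mem_map] at hzm
  obtain ⟨x, hx, rfl⟩ := hzm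
  exact ⟨x, rfl, isRoot_of_mem_roots hx⟩

theorem abs_lt_one_iff_half_lt {u : ℝ} (hu : u ≠ 0) : |1 - 1 / u| < 1 ↔ 1 / 2 < u := by
  rw [abs_lt]
  constructor
  · rintro ⟨h1, h2⟩
    have hpos : 0 < 1 / u := by linarith
    have hu' : 0 < u := by simpa using hpos
    have : 1 / u * u = 1 := by field_simp
    nlinarith
  · intro h
    have hu' : 0 < u := by linarith
    have hpos : 0 < 1 / u := by positivity
    have : 1 / u * u = 1 := by field_simp
    constructor <;> nlinarith

theorem exists_isInnerRoots (m : ℕ) (hm : 2 ≤ m) : ∃ q : Fin (m - 1) → ℝ, IsInnerRoots m q := by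
  obtain ⟨n, rfl⟩ : ∃ n, m = n + 1 := ⟨m - 1, by omega⟩
  have hk : 2 * (n + 1) - 2 = 2 * n := by omega
  set R := (geomPoly (2 * n + 1)).roots.toFinset.filter (fun u => 1 / 2 < u) with hR
  have hmem : ∀ u, u ∈ R ↔ (geomPoly (2 * n + 1)).eval u = 0 ∧ 1 / 2 < u := by
    intro u
    rw [hR, Finset.mem_filter, Multiset.mem_toFinset, mem_roots (geomPoly_ne_zero _), IsRoot.def]
  have hcard : (R.erase 1).card = n + 1 - 1 := by
    rw [Finset.card_erase_of_mem, card_roots_geomPoly_gt_half]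
    rw [hmem]
    exact ⟨eval_one_geomPoly _, by norm_num⟩
  let e := (R.erase 1).equivFinOfCardEq hcard
  refine ⟨fun k => 1 - 1 / (e.symm k : ℝ), ?_, ?_⟩
  · intro a b h
    have : (e.symm a : ℝ) = (e.symm b : ℝ) := by simpa using h
    exact e.symm.injective (Subtype.ext this)
  · intro z
    rw [hk]
    constructor
    · rintro ⟨hz, hz1⟩
      obtain ⟨x, rfl, hx⟩ := eulerPoly_complex_root _ hz
      have hx0 : x ≠ 0 := by
        rintro rfl; rw [eulerPoly_eval_zero] at hx; exact one_ne_zero hx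
      have hx1 : x ≠ 1 := by
        rintro rfl; exact (eulerPoly_eval_one_pos _).ne' hx
      have h1 : (1 - x) ≠ 0 := sub_ne_zero.mpr (Ne.symm hx1)
      have hxu : 1 - 1 / (1 / (1 - x)) = x := by simp
      have hu : 1 / (1 - x) ∈ R.erase 1 := by
        rw [Finset.mem_erase, hmem]
        refine ⟨?_, (eulerPoly_eval_eq_zero_iff _ hx0 hx1).mp hx, ?_⟩
        · intro h; apply hx0; field_simp at h; linarith
        · rw [← abs_lt_one_iff_half_lt (one_div_ne_zero h1), hxu]
          simpa using hz1
      refine ⟨e ⟨_, hu⟩, ?_⟩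
      simp
    · rintro ⟨k, rfl⟩
      beta_reduce
      obtain ⟨u, hu⟩ := e.symm k
      rw [Finset.mem_erase, hmem] at hu
      obtain ⟨hu1, hue, huh⟩ := hu
      have hu0 : u ≠ 0 := by intro h; rw [h] at huh; norm_num at huh
      have hx1 : 1 - 1 / u ≠ 1 := by simpa using hu0
      have hx0 : 1 - 1 / u ≠ 0 := by
        intro h; apply hu1; field_simp at h; linarith
      constructor
      · have : (eulerPoly (2 * n)).eval (1 - 1 / u) = 0 := by
          rw [eulerPoly_eval_eq_zero_iff _ hx0 hx1, powerSum]
          simpa using hue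
        have h2 : aeval ((1 - 1 / u : ℝ) : ℂ) (eulerPoly (2 * n))
            = (((eulerPoly (2 * n)).eval (1 - 1 / u) : ℝ) : ℂ) := by
          have := aeval_algebraMap_apply ℂ (1 - 1 / u) (eulerPoly (2 * n))
          simpa using this
        rw [h2, this]; simp
      · rw [Complex.norm_real, Real.norm_eq_abs]
        exact (abs_lt_one_iff_half_lt hu0).mpr huh

variable {m : ℕ} {q : Fin (m - 1) → ℝ}

theorem IsInnerRoots.abs_lt_one (hq : IsInnerRoots m q) (k : Fin (m - 1)) : |q k| < 1 := by
  have := ((hq.2 (q k)).mpr ⟨k, rfl⟩).2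
  simpa using this

theorem IsInnerRoots.eval_eq_zero (hq : IsInnerRoots m q) (k : Fin (m - 1)) :
    (eulerPoly (2 * m - 2)).eval (q k) = 0 := by
  have h := ((hq.2 (q k)).mpr ⟨k, rfl⟩).1
  have h2 := aeval_algebraMap_apply ℂ (q k) (eulerPoly (2 * m - 2))
  have h3 : (((eulerPoly (2 * m - 2)).eval (q k) : ℝ) : ℂ) = 0 := by
    rw [← h]; simpa using h2.symm
  exact_mod_cast h3

theorem IsInnerRoots.ne_zero (hq : IsInnerRoots m q) (k : Fin (m - 1)) : q k ≠ 0 := by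
  intro h
  have := hq.eval_eq_zero k
  rw [h, eulerPoly_eval_zero] at this
  exact one_ne_zero this

theorem IsInnerRoots.ne_one (hq : IsInnerRoots m q) (k : Fin (m - 1)) : q k ≠ 1 := by
  intro h
  have := hq.abs_lt_one k
  rw [h] at this; simp at this

theorem IsInnerRoots.powerSum_eq_zero (hq : IsInnerRoots m q) (k : Fin (m - 1)) :
    powerSum (2 * m - 1) (q k) = 0 := by
  have hm : 1 ≤ m - 1 := Nat.one_le_iff_ne_zero.mpr fun h => by
    have := k.2; omega
  have e : 2 * m - 1 = (2 * m - 2) + 1 := by omega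
  rw [e]
  exact (eulerPoly_eval_eq_zero_iff _ (hq.ne_zero k) (hq.ne_one k)).mp (hq.eval_eq_zero k)

theorem IsInnerRoots.powerSum_inv_eq_zero (hq : IsInnerRoots m q) (k : Fin (m - 1)) :
    powerSum (2 * m - 1) (q k)⁻¹ = 0 := by
  have e : 2 * m - 1 = (2 * m - 2) + 1 := by
    have := k.2; omega
  have h := hq.powerSum_eq_zero k
  rw [e] at h ⊢
  rw [powerSum_inv _ (hq.ne_zero k) (hq.ne_one k), h, mul_zero]

theorem IsInnerRoots.inv_ne_one (hq : IsInnerRoots m q) (k : Fin (m - 1)) : (q k)⁻¹ ≠ 1 := by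
  simpa using hq.ne_one k

/-- The polynomials `G_0, …, G_n` span the polynomials of degree at most `n + 1` without constant
term, so their values separate any `n + 1` points `u ≠ 0`. -/
theorem powerSum_linearIndependent {ι : Type*} [Fintype ι] [DecidableEq ι] (r a : ι → ℝ)
    (hinj : Function.Injective r) (hr : ∀ i, r i ≠ 1) {n : ℕ} (hn : Fintype.card ι ≤ n + 1)
    (h : ∀ l ≤ n, ∑ i, a i * powerSum l (r i) = 0) : a = 0 := by
  have key : ∀ l ≤ n, ∀ p : ℝ[X], p.natDegree ≤ l + 1 → p.eval 0 = 0 →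
      ∑ i, a i * p.eval (1 / (1 - r i)) = 0 := by
    have step : ∀ l ≤ n, (∀ p : ℝ[X], p.natDegree ≤ l → p.eval 0 = 0 →
        ∑ i, a i * p.eval (1 / (1 - r i)) = 0) → ∀ p : ℝ[X], p.natDegree ≤ l + 1 → p.eval 0 = 0 →
        ∑ i, a i * p.eval (1 / (1 - r i)) = 0 := by
      intro l hl ih p hp hp0
      set c := p.coeff (l + 1) / l.factorial
      have h1 := ih (p - C c * geomPoly l) ?_ ?_
      · simp only [eval_sub, eval_mul, eval_C, mul_sub, Finset.sum_sub_distrib] at h1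
        have h2 := h l hl
        simp only [powerSum] at h2
        have h3 : ∑ i, a i * (c * (geomPoly l).eval (1 / (1 - r i)))
            = c * ∑ i, a i * (geomPoly l).eval (1 / (1 - r i)) := by
          rw [Finset.mul_sum]; exact Finset.sum_congr rfl fun i _ => by ring
        rw [h3, h2] at h1
        linarith
      · have hle : (p - C c * geomPoly l).natDegree ≤ l + 1 :=
          (natDegree_sub_le _ _).trans (max_le hp ((natDegree_C_mul_le _ _).trans
            (natDegree_geomPoly_le l)))
        have hco : (p - C c * geomPoly l).coeff (l + 1) = 0 := by
          rw [coeff_sub, coeff_C_mul, coeff_geomPoly]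
          have : (l.factorial : ℝ) ≠ 0 := Nat.cast_ne_zero.mpr l.factorial_ne_zero
          simp only [c]; field_simp; ring
        rw [natDegree_le_iff_coeff_eq_zero] at hle ⊢
        intro N hN
        rcases Nat.lt_or_ge (l + 1) N with h' | h'
        · exact hle N h'
        · rw [show N = l + 1 by omega]; exact hco
      · simp [hp0, eval_zero_geomPoly]
    intro l
    induction l with
    | zero =>
      intro hl
      refine step 0 hl fun p hp hp0 => ?_
      rw [eq_C_of_natDegree_le_zero hp] at hp0 ⊢
      simp only [eval_C] at hp0
      simp [hp0]
    | succ l ih => intro hl; exact step _ hl (ih (by omega))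
  have hune : ∀ i, (1 - r i) ≠ 0 := fun i => sub_ne_zero.mpr (hr i).symm
  funext i
  have h1 := key n le_rfl (X * ∏ j ∈ Finset.univ.erase i, (X - C (1 / (1 - r j)))) ?_ (by simp)
  · rw [Finset.sum_eq_single i] at h1
    · have h2 : (X * ∏ j ∈ Finset.univ.erase i, (X - C (1 / (1 - r j)))).eval (1 / (1 - r i)) ≠ 0 := by
        rw [eval_mul, eval_X, eval_prod]
        refine mul_ne_zero (one_div_ne_zero (hune i)) (Finset.prod_ne_zero_iff.mpr fun j hj => ?_)
        simp only [eval_sub, eval_X, eval_C]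
        intro h0
        apply (Finset.mem_erase.mp hj).1
        apply hinj
        have := sub_eq_zero.mp h0
        rw [one_div, one_div, inv_inj] at this
        linarith
      simpa using (mul_eq_zero.mp h1).resolve_right h2
    · intro b _ hb
      rw [eval_mul, eval_prod, Finset.prod_eq_zero (i := b)
        (Finset.mem_erase.mpr ⟨hb, Finset.mem_univ b⟩)]
      · simp
      · simp
    · intro h; exact absurd (Finset.mem_univ i) h
  · refine natDegree_mul_le.trans ?_
    have h3 := natDegree_prod_le (Finset.univ.erase i) (fun j => X - C (1 / (1 - r j)))
    have h4 : (Finset.univ.erase i).card + 1 = Fintype.card ι := by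
      rw [Finset.card_erase_of_mem (Finset.mem_univ i), Finset.card_univ]
      have : 0 < Fintype.card ι := Fintype.card_pos_iff.mpr ⟨i⟩
      omega
    simp only [natDegree_X_sub_C, Finset.sum_const, smul_eq_mul, mul_one] at h3
    rw [natDegree_X]
    omega

end

/-! ### The spline as a sequence of polynomials -/

section

/-- The binomial transform of a sequence. -/
def binomTransform (a : ℕ → ℝ) (n : ℕ) : ℝ :=
  ∑ l ∈ Finset.range (n + 1), (n.choose l : ℝ) * a l

/-- The Appell polynomials of a sequence `a`, divided by `n!`: their exponential generating
function is `e^{tx}` times that of `a`. -/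
def appell (a : ℕ → ℝ) (n : ℕ) : ℝ[X] :=
  ∑ l ∈ Finset.range (n + 1), C (a l / (l.factorial * (n - l).factorial)) * X ^ (n - l)

theorem derivative_appell (a : ℕ → ℝ) (n : ℕ) : derivative (appell a (n + 1)) = appell a n := by
  rw [appell, Finset.sum_range_succ, derivative_add, derivative_sum, appell]
  simp only [Nat.sub_self, pow_zero, mul_one, derivative_C, add_zero]
  refine Finset.sum_congr rfl fun l hl => ?_
  have hl : l ≤ n := Nat.lt_succ_iff.mp (Finset.mem_range.mp hl)
  rw [derivative_C_mul, derivative_X_pow, ← mul_assoc, ← C_mul, Nat.succ_sub hl, Nat.succ_sub_one]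
  congr 2
  have h1 : (l.factorial : ℝ) ≠ 0 := Nat.cast_ne_zero.mpr l.factorial_ne_zero
  have h2 : ((n - l).factorial : ℝ) ≠ 0 := Nat.cast_ne_zero.mpr (n - l).factorial_ne_zero
  have h3 : ((n - l : ℕ) : ℝ) + 1 ≠ 0 := by positivity
  push_cast [Nat.factorial_succ]
  field_simp

theorem iterate_derivative_appell (a : ℕ → ℝ) (n j : ℕ) :
    derivative^[j] (appell a (n + j)) = appell a n := by
  induction j with
  | zero => rfl
  | succ j ih => rw [Function.iterate_succ_apply, ← add_assoc, derivative_appell, ih]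

theorem eval_zero_appell (a : ℕ → ℝ) (n : ℕ) : (appell a n).eval 0 = a n / n.factorial := by
  rw [appell, eval_finsetSum, Finset.sum_range_succ, Finset.sum_eq_zero]
  · simp
  · intro l hl
    have : n - l ≠ 0 := by have := Finset.mem_range.mp hl; omega
    simp [this]

theorem eval_one_appell (a : ℕ → ℝ) (n : ℕ) :
    (appell a n).eval 1 = binomTransform a n / n.factorial := by
  rw [appell, eval_finsetSum, binomTransform, Finset.sum_div]
  refine Finset.sum_congr rfl fun l hl => ?_
  have hl : l ≤ n := Nat.lt_succ_iff.mp (Finset.mem_range.mp hl)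
  have h1 : (l.factorial : ℝ) ≠ 0 := Nat.cast_ne_zero.mpr l.factorial_ne_zero
  have h2 : ((n - l).factorial : ℝ) ≠ 0 := Nat.cast_ne_zero.mpr (n - l).factorial_ne_zero
  have h3 : (n.factorial : ℝ) ≠ 0 := Nat.cast_ne_zero.mpr n.factorial_ne_zero
  rw [Nat.cast_choose ℝ hl]
  simp
  field_simp

theorem eq_of_derivative_eq {p r : ℝ[X]} (h : derivative p = derivative r)
    (h0 : p.eval 0 = r.eval 0) : p = r := by
  have h1 : derivative (p - r) = 0 := by rw [derivative_sub, h, sub_self]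
  have h2 := eq_C_of_derivative_eq_zero h1
  have h3 : (p - r).eval 0 = 0 := by rw [eval_sub, h0, sub_self]
  rw [h2, eval_C] at h3
  rw [h3, C_0] at h2
  exact sub_eq_zero.mp h2

theorem appell_comp_add_one (a : ℕ → ℝ) (n : ℕ) :
    (appell a n).comp (X + 1) = appell (binomTransform a) n := by
  induction n with
  | zero => simp [appell, binomTransform]
  | succ n ih =>
    refine eq_of_derivative_eq ?_ ?_
    · rw [derivative_comp, derivative_appell, derivative_appell, ih]; simp
    · rw [eval_zero_appell, eval_comp]
      simp [eval_one_appell]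

variable {ι : Type*} [Fintype ι] (m N : ℕ) (κ : ℝ) (q d p : ι → ℝ)

/-- `∑_k (d_k q_k^β ∑_γ γ^n q_k^{-γ} + p_k q_k^{N-β} ∑_γ γ^n q_k^γ)`, the local Taylor data of the
combination of exponential Euler splines with weights `d_k` and `p_k` at the knot `β`. -/
def expWeight (β n : ℕ) : ℝ :=
  ∑ k, (d k * q k ^ β * powerSum n (q k)⁻¹ + p k * q k ^ (N - β) * powerSum n (q k))

/-- The local Taylor data at the knot `β` of `κ` times a Bernoulli monospline plus the
exponential Euler splines. -/
def splineSeq (β : ℕ) : ℕ → ℝ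
  | 0 => κ
  | n + 1 => κ * (bernoulli (n + 1) : ℝ) - (n + 1) * expWeight N q d p β n

/-- The coefficient at the interior node `β`, divided by `h`. The derivative of order `2m - 1` of
the spline drops there by `h` times this number. -/
def splineJump (β : ℕ) : ℝ := κ + ∑ k, (d k * q k ^ β + p k * q k ^ (N - β))

theorem binomTransform_expWeight (h0 : ∀ k, q k ≠ 0) (h1 : ∀ k, q k ≠ 1) {β : ℕ} (hβ : β < N)
    (n : ℕ) : binomTransform (expWeight N q d p β) n
      = expWeight N q d p (β + 1) n
        - if n = 0 then ∑ k, (d k * q k ^ (β + 1) + p k * q k ^ (N - (β + 1))) else 0 := by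
  have e : (if n = 0 then ∑ k, (d k * q k ^ (β + 1) + p k * q k ^ (N - (β + 1))) else 0)
      = ∑ k, (d k * q k ^ (β + 1) + p k * q k ^ (N - (β + 1))) * (if n = 0 then 1 else 0) := by
    split_ifs <;> simp
  rw [e, expWeight, ← Finset.sum_sub_distrib, binomTransform]
  simp only [expWeight, Finset.mul_sum]
  rw [Finset.sum_comm]
  refine Finset.sum_congr rfl fun k _ => ?_
  have s1 := powerSum_shift n (r := (q k)⁻¹) (by simpa using h1 k)
  have s2 := powerSum_shift n (h1 k)
  have e1 : ∑ l ∈ Finset.range (n + 1), (n.choose l : ℝ) * (d k * q k ^ β * powerSum l (q k)⁻¹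
      + p k * q k ^ (N - β) * powerSum l (q k))
      = d k * q k ^ β * ∑ l ∈ Finset.range (n + 1), (n.choose l : ℝ) * powerSum l (q k)⁻¹
        + p k * q k ^ (N - β) * ∑ l ∈ Finset.range (n + 1), (n.choose l : ℝ) * powerSum l (q k) := by
    rw [Finset.mul_sum, Finset.mul_sum, ← Finset.sum_add_distrib]
    exact Finset.sum_congr rfl fun l _ => by ring
  rw [e1]
  have e2 : q k ^ (N - β) = q k ^ (N - (β + 1)) * q k := by
    rw [← pow_succ]; congr 1; omega
  have hk := h0 k
  rw [e2, pow_succ]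
  have s1' : ∑ l ∈ Finset.range (n + 1), (n.choose l : ℝ) * powerSum l (q k)⁻¹
      = q k * (powerSum n (q k)⁻¹ - if n = 0 then 1 else 0) := by
    rw [← s1]; field_simp
  rw [s1']
  linear_combination (p k * q k ^ (N - (β + 1))) * s2

theorem binomTransform_splineSeq (h0 : ∀ k, q k ≠ 0) (h1 : ∀ k, q k ≠ 1) {β : ℕ} (hβ : β < N)
    (n : ℕ) : binomTransform (splineSeq N κ q d p β) n
      = splineSeq N κ q d p (β + 1) n
        + if n = 1 then splineJump N κ q d p (β + 1) else 0 := by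
  rcases n with _ | n
  · simp [binomTransform, splineSeq]
  have hB := _root_.sum_bernoulli (n + 1)
  have hB' : ∑ l ∈ Finset.range (n + 1), ((n + 1).choose l : ℝ) * (bernoulli l : ℝ)
      = if n + 1 = 1 then 1 else 0 := by
    have := congrArg (fun x : ℚ => (x : ℝ)) hB
    push_cast at this
    rw [this]
    rcases Nat.eq_zero_or_pos n with rfl | hn
    · simp
    · simp [hn.ne']
  have hw := binomTransform_expWeight N q d p h0 h1 hβ n
  rw [binomTransform] at hw ⊢
  have e : ∀ l, splineSeq N κ q d p β l
      = κ * (bernoulli l : ℝ) - l * (if l = 0 then 0 else expWeight N q d p β (l - 1)) := by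
    intro l
    rcases l with _ | l
    · simp [splineSeq]
    · simp [splineSeq]
  simp only [e, mul_sub, Finset.sum_sub_distrib]
  rw [Finset.sum_range_succ (fun l => ((n + 1).choose l : ℝ) * (κ * (bernoulli l : ℝ))),
    Finset.sum_range_succ' (fun l => ((n + 1).choose l : ℝ)
      * (l * (if l = 0 then 0 else expWeight N q d p β (l - 1))))]
  have e1 : ∑ l ∈ Finset.range (n + 1), ((n + 1).choose l : ℝ) * (κ * (bernoulli l : ℝ))
      = κ * if n + 1 = 1 then 1 else 0 := by
    rw [← hB', Finset.mul_sum]; exact Finset.sum_congr rfl fun l _ => by ring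
  have e2 : ∑ l ∈ Finset.range (n + 1), ((n + 1).choose (l + 1) : ℝ) * (((l + 1 : ℕ) : ℝ)
      * (if l + 1 = 0 then 0 else expWeight N q d p β (l + 1 - 1)))
      = (n + 1) * ∑ l ∈ Finset.range (n + 1), (n.choose l : ℝ) * expWeight N q d p β l := by
    rw [Finset.mul_sum]
    refine Finset.sum_congr rfl fun l _ => ?_
    have := Nat.add_one_mul_choose_eq n l
    have : ((n : ℝ) + 1) * n.choose l = (n + 1).choose (l + 1) * ((l : ℝ) + 1) := by
      exact_mod_cast this
    rw [if_neg (Nat.succ_ne_zero l), Nat.add_sub_cancel]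
    push_cast
    linear_combination (-expWeight N q d p β l) * this
  rw [e1, e2, hw]
  rcases Nat.eq_zero_or_pos n with rfl | hn
  · simp [splineSeq, splineJump]; ring
  · simp [splineSeq, hn.ne']

/-- The spline on the interval to the right of the knot `β`, in the local coordinate `t ∈ [0,1]`.
The constant is chosen such that it vanishes at the knot. -/
def localPoly (β : ℕ) : ℝ[X] :=
  appell (splineSeq N κ q d p β) (2 * m) - C (κ * (bernoulli (2 * m) : ℝ) / (2 * m).factorial)

theorem iterate_derivative_localPoly (β : ℕ) {n : ℕ} (hn : n < 2 * m) :
    derivative^[2 * m - n] (localPoly m N κ q d p β) = appell (splineSeq N κ q d p β) n := by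
  obtain ⟨j, hj⟩ : ∃ j, 2 * m = n + (j + 1) := ⟨2 * m - n - 1, by omega⟩
  rw [localPoly, show 2 * m - n = j + 1 by omega, iterate_derivative_sub,
    iterate_derivative_C (by omega : 0 < j + 1)]
  rw [hj, iterate_derivative_appell, sub_zero]

theorem eval_zero_localPoly (hm : 1 ≤ m) (hw : ∀ β, expWeight N q d p β (2 * m - 1) = 0) (β : ℕ) :
    (localPoly m N κ q d p β).eval 0 = 0 := by
  rw [localPoly, eval_sub, eval_C, eval_zero_appell]
  obtain ⟨n, hn⟩ : ∃ n, 2 * m = n + 1 := ⟨2 * m - 1, by omega⟩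
  have := hw β
  rw [hn, Nat.add_sub_cancel] at this
  rw [hn, splineSeq, this]
  simp

theorem appell_add (a b : ℕ → ℝ) (n : ℕ) :
    appell (fun l => a l + b l) n = appell a n + appell b n := by
  simp only [appell, ← Finset.sum_add_distrib, add_div, C_add, add_mul]

theorem appell_single (c : ℝ) (n : ℕ) :
    appell (fun l => if l = 1 then c else 0) (n + 1) = C (c / n.factorial) * X ^ n := by
  rw [appell, Finset.sum_eq_single 1]
  · simp
  · intro b _ hb; simp [hb]
  · intro h; exact absurd (Finset.mem_range.mpr (by omega)) h

theorem localPoly_comp_add_one (hm : 1 ≤ m) (h0 : ∀ k, q k ≠ 0) (h1 : ∀ k, q k ≠ 1) {β : ℕ}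
    (hβ : β < N) : (localPoly m N κ q d p β).comp (X + 1) = localPoly m N κ q d p (β + 1)
      + C (splineJump N κ q d p (β + 1) / (2 * m - 1).factorial) * X ^ (2 * m - 1) := by
  rw [localPoly, localPoly, sub_comp, C_comp, appell_comp_add_one]
  have e : binomTransform (splineSeq N κ q d p β) = fun n => splineSeq N κ q d p (β + 1) n
        + if n = 1 then splineJump N κ q d p (β + 1) else 0 := by
    funext n; exact binomTransform_splineSeq N κ q d p h0 h1 hβ n
  rw [e, appell_add]
  obtain ⟨n, hn⟩ : ∃ n, 2 * m = n + 1 := ⟨2 * m - 1, by omega⟩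
  rw [hn, Nat.add_sub_cancel, appell_single]
  ring

/-- The spline on the interval `[hβ, h(β+1)]`, `h = 1 / N`. -/
def splinePoly (β : ℕ) : ℝ[X] :=
  C ((1 / (N : ℝ)) ^ (2 * m)) * (localPoly m N κ q d p β).comp (C (N : ℝ) * X - C (β : ℝ))

theorem iterate_derivative_comp_linear (f : ℝ[X]) (a b : ℝ) (j : ℕ) :
    derivative^[j] (f.comp (C a * X - C b)) = C (a ^ j) * (derivative^[j] f).comp (C a * X - C b) := by
  induction j with
  | zero => simp
  | succ j ih =>
    rw [Function.iterate_succ_apply', ih, derivative_C_mul, derivative_comp,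
      Function.iterate_succ_apply']
    simp only [derivative_sub, derivative_C_mul, derivative_X, derivative_C, pow_succ, C_mul]
    ring

variable {N}

theorem iterate_derivative_splinePoly (hN : 1 ≤ N) (β : ℕ) {n : ℕ} (hn : n < 2 * m) :
    derivative^[2 * m - n] (splinePoly m N κ q d p β) = C ((1 / (N : ℝ)) ^ n) *
      (appell (splineSeq N κ q d p β) n).comp (C (N : ℝ) * X - C (β : ℝ)) := by
  have hN' : (N : ℝ) ≠ 0 := by positivity
  rw [splinePoly, iterate_derivative_C_mul, iterate_derivative_comp_linear,
    iterate_derivative_localPoly m N κ q d p β hn, ← mul_assoc, ← C_mul]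
  congr 2
  have : (1 / (N : ℝ)) ^ (2 * m) = (1 / (N : ℝ)) ^ n * (1 / (N : ℝ)) ^ (2 * m - n) := by
    rw [← pow_add]; congr 1; omega
  rw [this, mul_assoc, ← mul_pow, one_div, inv_mul_cancel₀ hN', one_pow, mul_one]

theorem eval_iterate_derivative_splinePoly (hN : 1 ≤ N) (β : ℕ) {n : ℕ} (hn : n < 2 * m) :
    (derivative^[2 * m - n] (splinePoly m N κ q d p β)).eval (1 / (N : ℝ) * β)
      = (1 / (N : ℝ)) ^ n * splineSeq N κ q d p β n / n.factorial := by
  have hN' : (N : ℝ) ≠ 0 := by positivity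
  rw [iterate_derivative_splinePoly m κ q d p hN β hn]
  simp only [eval_mul, eval_C, eval_comp, eval_sub, eval_X]
  rw [show (N : ℝ) * (1 / (N : ℝ) * β) - β = 0 by field_simp; ring, eval_zero_appell, mul_div_assoc]

theorem iterate_derivative_splinePoly_top (hm : 1 ≤ m) (hN : 1 ≤ N) (β : ℕ) :
    derivative^[2 * m] (splinePoly m N κ q d p β) = C κ := by
  have h := iterate_derivative_splinePoly m κ q d p hN β (n := 0) (by omega)
  rw [Nat.sub_zero] at h
  rw [h]
  simp [appell, splineSeq]

theorem eval_splinePoly (hm : 1 ≤ m) (hN : 1 ≤ N) (hw : ∀ β, expWeight N q d p β (2 * m - 1) = 0)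
    (β : ℕ) : (splinePoly m N κ q d p β).eval (1 / (N : ℝ) * β) = 0 := by
  have hN' : (N : ℝ) ≠ 0 := by positivity
  rw [splinePoly]
  simp only [eval_mul, eval_C, eval_comp, eval_sub, eval_X]
  rw [show (N : ℝ) * (1 / (N : ℝ) * β) - β = 0 by field_simp; ring,
    eval_zero_localPoly m N κ q d p hm hw, mul_zero]

theorem splinePoly_eq_succ (hm : 1 ≤ m) (hN : 1 ≤ N) (h0 : ∀ k, q k ≠ 0) (h1 : ∀ k, q k ≠ 1) {β : ℕ}
    (hβ : β < N) : splinePoly m N κ q d p β = splinePoly m N κ q d p (β + 1)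
      + C (1 / (N : ℝ) * splineJump N κ q d p (β + 1) / (2 * m - 1).factorial)
        * (X - C (1 / (N : ℝ) * (β + 1 : ℕ))) ^ (2 * m - 1) := by
  have hN' : (N : ℝ) ≠ 0 := by positivity
  have h := congrArg (fun f : ℝ[X] => f.comp (C (N : ℝ) * X - C ((β + 1 : ℕ) : ℝ)))
    (localPoly_comp_add_one m N κ q d p hm h0 h1 hβ)
  simp only [comp_assoc, add_comp, mul_comp, C_comp, X_pow_comp, X_comp, one_comp] at h
  have e1 : C (N : ℝ) * X - C ((β + 1 : ℕ) : ℝ) + 1 = C (N : ℝ) * X - C (β : ℝ) := by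
    push_cast; simp only [C_add, C_1]; ring
  have e2 : C (N : ℝ) * X - C ((β + 1 : ℕ) : ℝ)
      = C (N : ℝ) * (X - C (1 / (N : ℝ) * (β + 1 : ℕ))) := by
    rw [mul_sub, ← C_mul]; congr 2; field_simp
  rw [e1] at h
  rw [splinePoly, h, mul_add, splinePoly]
  congr 1
  rw [e2, mul_pow, ← C_pow, ← mul_assoc, ← mul_assoc, ← C_mul, ← C_mul]
  congr 2
  have : (1 / (N : ℝ)) ^ (2 * m) = (1 / (N : ℝ)) * (1 / (N : ℝ)) ^ (2 * m - 1) := by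
    rw [← pow_succ']; congr 1; omega
  rw [this]
  have : (1 / (N : ℝ)) ^ (2 * m - 1) * (N : ℝ) ^ (2 * m - 1) = 1 := by
    rw [← mul_pow, one_div, inv_mul_cancel₀ hN', one_pow]
  linear_combination (1 / (N : ℝ) * splineJump N κ q d p (β + 1) / (2 * m - 1).factorial) * this

end

/-! ### Sobolev functions and Green's formula -/

section

theorem uniqueDiffOn_unit : UniqueDiffOn ℝ (Icc (0 : ℝ) 1) := uniqueDiffOn_Icc zero_lt_one

theorem iteratedDerivWithin_of_contDiff {n : ℕ} {f : ℝ → ℝ} (hf : ContDiff ℝ n f) {j : ℕ}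
    (hj : j ≤ n) {x : ℝ} (hx : x ∈ Icc (0 : ℝ) 1) :
    iteratedDerivWithin j f (Icc 0 1) x = iteratedDeriv j f x :=
  iteratedDerivWithin_eq_iteratedDeriv uniqueDiffOn_unit
    ((hf.of_le (by exact_mod_cast hj)).contDiffAt) hx

theorem isSobolev_of_contDiff {m : ℕ} (hm : 1 ≤ m) {f : ℝ → ℝ} (hf : ContDiff ℝ m f) :
    IsSobolev m f := by
  obtain ⟨n, rfl⟩ : ∃ n, m = n + 1 := ⟨m - 1, by omega⟩
  have hcd : ContDiffOn ℝ ((n + 1 : ℕ) : WithTop ℕ∞) f (Icc 0 1) := hf.contDiffOn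
  have h2 := (contDiffOn_nat_succ_iff_contDiffOn_one_iteratedDerivWithin uniqueDiffOn_unit).mp hcd
  refine ⟨by simpa using h2.1, ?_, ?_⟩
  · refine ContDiffOn.absolutelyContinuousOnInterval ?_
    rw [uIcc_of_le zero_le_one]
    simpa using h2.2
  · have hc : ContinuousOn (iteratedDerivWithin (n + 1) f (Icc 0 1)) (Icc 0 1) :=
      hcd.continuousOn_iteratedDerivWithin le_rfl uniqueDiffOn_unit
    obtain ⟨K, hK⟩ := isCompact_Icc.exists_bound_of_continuousOn hc
    refine MemLp.of_bound (hc.aestronglyMeasurable measurableSet_Icc) K ?_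
    exact (ae_restrict_iff' measurableSet_Icc).mpr (Filter.Eventually.of_forall hK)

variable {m : ℕ} {φ : ℝ → ℝ}

theorem contDiff_polynomial (p : ℝ[X]) {n : WithTop ℕ∞} : ContDiff ℝ n fun x => p.eval x := by
  simpa using p.contDiff_aeval (𝕜 := ℝ) n

theorem IsSobolev.absolutelyContinuous (hφ : IsSobolev m φ) {i : ℕ} (hi : i < m) :
    AbsolutelyContinuousOnInterval (iteratedDerivWithin i φ (Icc 0 1)) 0 1 := by
  rcases Nat.lt_or_ge i (m - 1) with h | h
  · have hcd : ContDiffOn ℝ ((i + 1 : ℕ) : WithTop ℕ∞) φ (Icc 0 1) :=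
      hφ.contDiffOn.of_le (by exact_mod_cast h)
    have h2 := (contDiffOn_nat_succ_iff_contDiffOn_one_iteratedDerivWithin uniqueDiffOn_unit).mp hcd
    refine ContDiffOn.absolutelyContinuousOnInterval ?_
    rw [uIcc_of_le zero_le_one]
    exact h2.2
  · rw [show i = m - 1 by omega]
    exact hφ.absCont

theorem deriv_iteratedDerivWithin {i : ℕ} {x : ℝ} (hx : x ∈ Ioo (0 : ℝ) 1) :
    deriv (iteratedDerivWithin i φ (Icc 0 1)) x = iteratedDerivWithin (i + 1) φ (Icc 0 1) x := by
  rw [iteratedDerivWithin_succ, derivWithin_of_mem_nhds (Icc_mem_nhds hx.1 hx.2)]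

theorem IsSobolev.intervalIntegrable (hφ : IsSobolev m φ) {a b : ℝ} (ha : 0 ≤ a) (hab : a ≤ b)
    (hb : b ≤ 1) :
    IntervalIntegrable (iteratedDerivWithin m φ (Icc 0 1)) volume a b := by
  rw [intervalIntegrable_iff_integrableOn_Icc_of_le hab]
  have h : IntegrableOn (iteratedDerivWithin m φ (Icc 0 1)) (Icc 0 1) :=
    hφ.memLp.integrable (by norm_num)
  exact h.mono_set (Icc_subset_Icc ha hb)

theorem ae_Ioo_of_mem_uIoc {a b : ℝ} (ha : 0 ≤ a) (hab : a ≤ b) (hb : b ≤ 1) :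
    ∀ᵐ x : ℝ, x ∈ uIoc a b → x ∈ Ioo (0 : ℝ) 1 := by
  have h1 : ∀ᵐ x : ℝ, x ≠ 1 := by simp [ae_iff, measure_singleton]
  filter_upwards [h1] with x hx hxab
  rw [uIoc_of_le hab] at hxab
  exact ⟨ha.trans_lt hxab.1, lt_of_le_of_ne (hxab.2.trans hb) hx⟩

theorem IsSobolev.integral_by_parts (hφ : IsSobolev m φ) {i : ℕ} (hi : i < m) (p : ℝ[X])
    {a b : ℝ} (ha : 0 ≤ a) (hab : a ≤ b) (hb : b ≤ 1) :
    ∫ x in a..b, p.eval x * iteratedDerivWithin (i + 1) φ (Icc 0 1) x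
      = p.eval b * iteratedDerivWithin i φ (Icc 0 1) b
        - p.eval a * iteratedDerivWithin i φ (Icc 0 1) a
        - ∫ x in a..b, (derivative p).eval x * iteratedDerivWithin i φ (Icc 0 1) x := by
  have h1 : AbsolutelyContinuousOnInterval (iteratedDerivWithin i φ (Icc 0 1)) a b :=
    (hφ.absolutelyContinuous hi).mono (by
      rw [uIcc_of_le hab, uIcc_of_le zero_le_one]; exact Icc_subset_Icc ha hb)
  have h2 : AbsolutelyContinuousOnInterval (fun x => p.eval x) a b :=
    ContDiffOn.absolutelyContinuousOnInterval (contDiff_polynomial p).contDiffOn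
  have h := h2.integral_mul_deriv_eq_deriv_mul h1
  simp only [Polynomial.deriv] at h
  rw [← h]
  refine intervalIntegral.integral_congr_ae ?_
  filter_upwards [ae_Ioo_of_mem_uIoc ha hab hb] with x hx hxab
  rw [deriv_iteratedDerivWithin (hx hxab)]

theorem IsSobolev.integral_by_parts_iterate (hφ : IsSobolev m φ) {n : ℕ} (hn : n ≤ m) (p : ℝ[X])
    {a b : ℝ} (ha : 0 ≤ a) (hab : a ≤ b) (hb : b ≤ 1) :
    ∫ x in a..b, p.eval x * iteratedDerivWithin n φ (Icc 0 1) x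
      = ∑ i ∈ Finset.range n, (-1) ^ i *
          ((derivative^[i] p).eval b * iteratedDerivWithin (n - 1 - i) φ (Icc 0 1) b
            - (derivative^[i] p).eval a * iteratedDerivWithin (n - 1 - i) φ (Icc 0 1) a)
        + (-1) ^ n * ∫ x in a..b, (derivative^[n] p).eval x * φ x := by
  induction n generalizing p with
  | zero => simp
  | succ n ih =>
    rw [hφ.integral_by_parts hn p ha hab hb, ih (by omega), Finset.sum_range_succ']
    simp only [Function.iterate_succ_apply, Function.iterate_zero, id_eq, pow_zero, one_mul,
      Nat.add_sub_cancel, Nat.sub_zero]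
    have e : ∀ f : ℕ → ℕ → ℝ, ∑ i ∈ Finset.range n, (-1) ^ (i + 1) * f i (n - (i + 1))
        = -∑ i ∈ Finset.range n, (-1) ^ i * f i (n - 1 - i) := by
      intro f
      rw [← Finset.sum_neg_distrib]
      refine Finset.sum_congr rfl fun i _ => ?_
      rw [show n - (i + 1) = n - 1 - i by omega]
      ring
    rw [e fun i l => (derivative^[i] (derivative p)).eval b * iteratedDerivWithin l φ (Icc 0 1) b
      - (derivative^[i] (derivative p)).eval a * iteratedDerivWithin l φ (Icc 0 1) a]
    ring

/-- Green's formula for a piecewise polynomial of degree `2m` with simple knots at `β / N`: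
integration by parts leaves the point values of `φ` at the knots, weighted with the jumps `c`, and
the boundary terms, in which the derivative of order `2m - 1 - j` is paired with that of
order `j`. -/
theorem IsSobolev.green (hφ : IsSobolev m φ) (hm : 1 ≤ m) {N : ℕ} (hN : 1 ≤ N) (P : ℕ → ℝ[X])
    (c : ℕ → ℝ) (κ : ℝ) (hP : ∀ β < N, P β = P (β + 1)
      + C (c (β + 1) / (2 * m - 1).factorial) * (X - C (1 / (N : ℝ) * (β + 1 : ℕ))) ^ (2 * m - 1))
    (hκ : ∀ β, derivative^[2 * m] (P β) = C κ) :
    (-1) ^ m * ∑ β ∈ Finset.range N, ∫ x in (1 / (N : ℝ) * β)..(1 / (N : ℝ) * (β + 1 : ℕ)),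
        (derivative^[m] (P β)).eval x * iteratedDerivWithin m φ (Icc 0 1) x
      = κ * (∫ x in (0 : ℝ)..1, φ x) - ∑ β ∈ Finset.range N, c (β + 1) * φ (1 / (N : ℝ) * (β + 1 : ℕ))
        + ∑ j ∈ Finset.range m, (-1) ^ (j + 1) *
          ((derivative^[2 * m - 1 - j] (P N)).eval 1 * iteratedDerivWithin j φ (Icc 0 1) 1
          - (derivative^[2 * m - 1 - j] (P 0)).eval 0 * iteratedDerivWithin j φ (Icc 0 1) 0) := by
  have hN' : (0 : ℝ) < N := by exact_mod_cast hN
  set D := fun i => iteratedDerivWithin i φ (Icc 0 1) with hD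
  have hnode : ∀ β ≤ N, (1 / (N : ℝ) * β) ≤ 1 := by
    intro β hβ
    rw [one_div, inv_mul_le_iff₀ hN', mul_one]
    exact_mod_cast hβ
  have hφc : ContinuousOn φ (Icc 0 1) := hφ.contDiffOn.continuousOn
  -- Each piece is integrated by parts separately.
  have hpiece : ∀ β ∈ Finset.range N,
      ∫ x in (1 / (N : ℝ) * β)..(1 / (N : ℝ) * (β + 1 : ℕ)), (derivative^[m] (P β)).eval x * D m x
      = (∑ i ∈ Finset.range m, (-1) ^ i *
          ((derivative^[m + i] (P (β + 1))).eval (1 / (N : ℝ) * (β + 1 : ℕ))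
              * D (m - 1 - i) (1 / (N : ℝ) * (β + 1 : ℕ))
            - (derivative^[m + i] (P β)).eval (1 / (N : ℝ) * β) * D (m - 1 - i) (1 / (N : ℝ) * β)))
        + (-1) ^ (m - 1) * (c (β + 1) * φ (1 / (N : ℝ) * (β + 1 : ℕ)))
        + (-1) ^ m * (κ * ∫ x in (1 / (N : ℝ) * β)..(1 / (N : ℝ) * (β + 1 : ℕ)), φ x) := by
    intro β hβ
    have hβ := Finset.mem_range.mp hβ
    have hle : (1 / (N : ℝ) * β) ≤ (1 / (N : ℝ) * (β + 1 : ℕ)) := by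
      gcongr; simp
    rw [hφ.integral_by_parts_iterate le_rfl (derivative^[m] (P β)) (by positivity) hle
      (hnode _ hβ)]
    have hit : ∀ i, derivative^[i] (derivative^[m] (P β)) = derivative^[m + i] (P β) := by
      intro i; rw [← Function.iterate_add_apply, add_comm]
    simp only [hit]
    rw [← two_mul, hκ]
    simp only [eval_C, intervalIntegral.integral_const_mul]
    congr 1
    have hstep : ∀ i ∈ Finset.range m,
        (derivative^[m + i] (P β)).eval (1 / (N : ℝ) * (β + 1 : ℕ))
        = (derivative^[m + i] (P (β + 1))).eval (1 / (N : ℝ) * (β + 1 : ℕ))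
          + if i = m - 1 then c (β + 1) else 0 := by
      intro i hi
      have hi := Finset.mem_range.mp hi
      rw [hP β hβ, iterate_map_add, iterate_derivative_C_mul, iterate_derivative_X_sub_pow,
        eval_add]
      congr 1
      split_ifs with h
      · subst h
        rw [show m + (m - 1) = 2 * m - 1 by omega, Nat.sub_self, Nat.descFactorial_self]
        have := (2 * m - 1).factorial_ne_zero
        simp only [eval_mul, eval_C, pow_zero, nsmul_eq_mul, mul_one, eval_natCast]
        field_simp
      · have : 2 * m - 1 - (m + i) ≠ 0 := by omega
        simp [this]
    rw [Finset.sum_congr rfl fun i hi => by rw [hstep i hi]]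
    rw [show (-1 : ℝ) ^ (m - 1) * (c (β + 1) * φ (1 / (N : ℝ) * (β + 1 : ℕ)))
      = ∑ i ∈ Finset.range m, (-1) ^ i * ((if i = m - 1 then c (β + 1) else 0)
          * D (m - 1 - i) (1 / (N : ℝ) * (β + 1 : ℕ))) by
        rw [Finset.sum_eq_single (m - 1)]
        · simp [hD]
        · intro b _ hb; simp [hb]
        · intro h; exact absurd (Finset.mem_range.mpr (by omega)) h,
      ← Finset.sum_add_distrib]
    refine Finset.sum_congr rfl fun i _ => ?_
    ring
  rw [Finset.sum_congr rfl hpiece, Finset.sum_add_distrib, Finset.sum_add_distrib,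
    Finset.sum_comm]
  -- The boundary terms at the interior knots telescope.
  have htel : ∀ i, ∑ β ∈ Finset.range N, (-1) ^ i *
          ((derivative^[m + i] (P (β + 1))).eval (1 / (N : ℝ) * (β + 1 : ℕ))
              * D (m - 1 - i) (1 / (N : ℝ) * (β + 1 : ℕ))
            - (derivative^[m + i] (P β)).eval (1 / (N : ℝ) * β) * D (m - 1 - i) (1 / (N : ℝ) * β))
      = (-1) ^ i * ((derivative^[m + i] (P N)).eval 1 * D (m - 1 - i) 1
          - (derivative^[m + i] (P 0)).eval 0 * D (m - 1 - i) 0) := by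
    intro i
    rw [← Finset.mul_sum, Finset.sum_range_sub (fun β : ℕ =>
      (derivative^[m + i] (P β)).eval (1 / (N : ℝ) * β) * D (m - 1 - i) (1 / (N : ℝ) * β))]
    simp only [Nat.cast_zero, mul_zero]
    rw [show 1 / (N : ℝ) * (N : ℝ) = 1 by field_simp]
  rw [Finset.sum_congr rfl fun i _ => htel i]
  have hint : ∑ β ∈ Finset.range N, (-1 : ℝ) ^ m *
      (κ * ∫ x in (1 / (N : ℝ) * β)..(1 / (N : ℝ) * (β + 1 : ℕ)), φ x)
      = (-1) ^ m * (κ * ∫ x in (0 : ℝ)..1, φ x) := by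
    rw [← Finset.mul_sum, ← Finset.mul_sum]
    have h := intervalIntegral.sum_integral_adjacent_intervals (f := φ) (μ := volume)
      (a := fun β : ℕ => 1 / (N : ℝ) * β) (n := N) (fun k hk => ?_)
    · rw [h]
      simp only [Nat.cast_zero, mul_zero]
      rw [show 1 / (N : ℝ) * (N : ℝ) = 1 by field_simp]
    · refine ContinuousOn.intervalIntegrable (hφc.mono ?_)
      have hle : (1 / (N : ℝ) * k) ≤ (1 / (N : ℝ) * (k + 1 : ℕ)) := by
        gcongr; simp
      rw [uIcc_of_le hle]
      exact Icc_subset_Icc (by positivity) (hnode _ hk)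
  rw [hint, ← Finset.mul_sum]
  have hrefl : ∑ j ∈ Finset.range m, (-1) ^ (j + 1) *
      ((derivative^[2 * m - 1 - j] (P N)).eval 1 * D j 1
          - (derivative^[2 * m - 1 - j] (P 0)).eval 0 * D j 0)
      = (-1) ^ m * ∑ i ∈ Finset.range m, (-1) ^ i *
        ((derivative^[m + i] (P N)).eval 1 * D (m - 1 - i) 1
          - (derivative^[m + i] (P 0)).eval 0 * D (m - 1 - i) 0) := by
    rw [← Finset.sum_range_reflect, Finset.mul_sum]
    refine Finset.sum_congr rfl fun i hi => ?_
    have hi := Finset.mem_range.mp hi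
    rw [show 2 * m - 1 - (m - 1 - i) = m + i by omega, ← mul_assoc, ← pow_add]
    congr 1
    rw [show m + i = (m - 1 - i + 1) + 2 * i by omega, pow_add _ (m - 1 - i + 1), pow_mul]
    simp
  rw [hrefl]
  have hs : (-1 : ℝ) ^ m * (-1) ^ m = 1 := by rw [← mul_pow]; simp
  have hs' : (-1 : ℝ) ^ m * (-1) ^ (m - 1) = -1 := by
    rw [← pow_add, show m + (m - 1) = 2 * (m - 1) + 1 by omega, pow_succ, pow_mul]; simp
  linear_combination (κ * ∫ x in (0 : ℝ)..1, φ x) * hs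
    + (∑ β ∈ Finset.range N, c (β + 1) * φ (1 / (N : ℝ) * (β + 1 : ℕ))) * hs'

end

/-! ### Splines as functions on the line -/

section

theorem hasDerivAt_max_pow (a : ℝ) (n : ℕ) (x : ℝ) :
    HasDerivAt (fun y => max (y - a) 0 ^ (n + 2)) ((n + 2) * max (x - a) 0 ^ (n + 1)) x := by
  rcases lt_trichotomy x a with h | h | h
  · have h1 : (fun y => max (y - a) 0 ^ (n + 2)) =ᶠ[nhds x] fun _ => (0 : ℝ) := by
      filter_upwards [Iio_mem_nhds h] with y hy
      rw [max_eq_right (by simpa using (le_of_lt hy)), zero_pow (by omega)]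
    rw [max_eq_right (by linarith), zero_pow (by omega), mul_zero]
    exact (hasDerivAt_const x (0 : ℝ)).congr_of_eventuallyEq h1
  · subst h
    rw [sub_self, max_self, zero_pow (by omega), mul_zero, hasDerivAt_iff_isLittleO]
    refine Asymptotics.IsBigO.trans_isLittleO ?_
      (Asymptotics.isLittleO_pow_sub_sub x (m := n + 2) (by omega))
    refine Asymptotics.IsBigO.of_bound 1 (Filter.Eventually.of_forall fun y => ?_)
    simp only [sub_self, max_self, smul_zero, sub_zero, ne_eq, Nat.succ_ne_zero, not_false_eq_true,
      zero_pow, norm_pow, one_mul, norm_norm]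
    gcongr
    rw [Real.norm_eq_abs, Real.norm_eq_abs, abs_of_nonneg (le_max_right _ _)]
    exact max_le (le_abs_self _) (abs_nonneg _)
  · have h1 : (fun y => max (y - a) 0 ^ (n + 2)) =ᶠ[nhds x] fun y => (y - a) ^ (n + 2) := by
      filter_upwards [Ioi_mem_nhds h] with y hy
      rw [max_eq_left (by simpa using (le_of_lt hy))]
    rw [max_eq_left (by linarith)]
    have h2 := ((hasDerivAt_id x).sub_const a).pow (n + 2)
    refine HasDerivAt.congr_of_eventuallyEq ?_ h1
    exact h2.congr_deriv (by simp)

theorem iteratedDeriv_of_hasDerivAt {K : ℕ} {F : ℕ → ℝ → ℝ}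
    (hF : ∀ j < K, ∀ x, HasDerivAt (F j) (F (j + 1) x) x) {j : ℕ} (hj : j ≤ K) :
    iteratedDeriv j (F 0) = F j := by
  induction j with
  | zero => simp
  | succ j ih =>
    rw [iteratedDeriv_succ, ih (by omega)]
    funext x
    exact (hF j hj x).deriv

theorem contDiff_of_hasDerivAt {K : ℕ} {F : ℕ → ℝ → ℝ}
    (hF : ∀ j < K, ∀ x, HasDerivAt (F j) (F (j + 1) x) x) (hK : Continuous (F K)) :
    ContDiff ℝ K (F 0) := by
  rw [contDiff_nat_iff_iteratedDeriv]
  constructor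
  · intro j hj
    rw [iteratedDeriv_of_hasDerivAt hF hj]
    rcases Nat.lt_or_ge j K with h | h
    · exact continuous_iff_continuousAt.mpr fun x => (hF j h x).continuousAt
    · rw [show j = K by omega]; exact hK
  · intro j hj
    rw [iteratedDeriv_of_hasDerivAt hF hj.le]
    exact fun x => (hF j hj x).differentiableAt

theorem iteratedDeriv_polynomial (p : ℝ[X]) (j : ℕ) :
    iteratedDeriv j (fun x => p.eval x) = fun x => (derivative^[j] p).eval x :=
  iteratedDeriv_of_hasDerivAt (K := j) (F := fun j x => (derivative^[j] p).eval x)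
    (fun i _ x => by rw [Function.iterate_succ_apply']; exact Polynomial.hasDerivAt _ x) le_rfl

/-- The derivative of order `j` of the spline of degree `n` (plus a global polynomial) which is
`p` to the left of the knot `1 / N` and whose derivative of order `n` jumps by `-c β` at `β / N`,
`1 ≤ β ≤ N - 1`, written with truncated powers. -/
def splineDeriv (n N : ℕ) (p : ℝ[X]) (c : ℕ → ℝ) (j : ℕ) (x : ℝ) : ℝ :=
  (derivative^[j] p).eval x - ∑ γ ∈ Finset.range (N - 1),
    c (γ + 1) / (n - j).factorial * max (x - 1 / (N : ℝ) * (γ + 1 : ℕ)) 0 ^ (n - j)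

theorem hasDerivAt_splineDeriv (n N : ℕ) (p : ℝ[X]) (c : ℕ → ℝ) {j : ℕ} (hj : j + 1 < n) (x : ℝ) :
    HasDerivAt (splineDeriv n N p c j) (splineDeriv n N p c (j + 1) x) x := by
  obtain ⟨i, rfl⟩ : ∃ i, n = j + (i + 2) := ⟨n - j - 2, by omega⟩
  have e1 : j + (i + 2) - j = i + 2 := by omega
  have e2 : j + (i + 2) - (j + 1) = i + 1 := by omega
  unfold splineDeriv
  rw [e1, e2, Function.iterate_succ_apply']
  refine (Polynomial.hasDerivAt _ x).sub (HasDerivAt.fun_sum fun γ _ => ?_)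
  refine ((hasDerivAt_max_pow (1 / (N : ℝ) * (γ + 1 : ℕ)) i x).const_mul _).congr_deriv ?_
  have h1 : ((i + 1).factorial : ℝ) ≠ 0 := Nat.cast_ne_zero.mpr (i + 1).factorial_ne_zero
  have h2 : (i : ℝ) + 1 + 1 ≠ 0 := by positivity
  rw [Nat.factorial_succ (i + 1)]
  push_cast
  field_simp
  ring

theorem continuous_splineDeriv (n N : ℕ) (p : ℝ[X]) (c : ℕ → ℝ) (j : ℕ) :
    Continuous (splineDeriv n N p c j) := by
  unfold splineDeriv
  fun_prop

theorem contDiff_splineDeriv (n N : ℕ) (p : ℝ[X]) (c : ℕ → ℝ) :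
    ContDiff ℝ (n - 1 : ℕ) (splineDeriv n N p c 0) :=
  contDiff_of_hasDerivAt (F := splineDeriv n N p c)
    (fun _ hj x => hasDerivAt_splineDeriv n N p c (by omega) x)
    (continuous_splineDeriv _ _ _ _ _)

theorem iteratedDeriv_splineDeriv (n N : ℕ) (p : ℝ[X]) (c : ℕ → ℝ) {j : ℕ} (hj : j ≤ n - 1) :
    iteratedDeriv j (splineDeriv n N p c 0) = splineDeriv n N p c j :=
  iteratedDeriv_of_hasDerivAt (F := splineDeriv n N p c)
    (fun _ hj x => hasDerivAt_splineDeriv n N p c (by omega) x) hj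

theorem iterate_derivative_eq_of_jumps {n N : ℕ} {P : ℕ → ℝ[X]} {c : ℕ → ℝ}
    (hP : ∀ β < N, P β = P (β + 1)
      + C (c (β + 1) / n.factorial) * (X - C (1 / (N : ℝ) * (β + 1 : ℕ))) ^ n)
    {β : ℕ} (hβ : β ≤ N) {j : ℕ} (hj : j ≤ n) :
    derivative^[j] (P β) = derivative^[j] (P 0) - ∑ γ ∈ Finset.range β,
      C (c (γ + 1) / (n - j).factorial) * (X - C (1 / (N : ℝ) * (γ + 1 : ℕ))) ^ (n - j) := by
  induction β with
  | zero => simp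
  | succ β ih =>
    rw [Finset.sum_range_succ, ← sub_sub, ← ih (by omega), hP β hβ, iterate_map_add,
      iterate_derivative_C_mul, iterate_derivative_X_sub_pow]
    have h1 : (n.factorial : ℝ) ≠ 0 := Nat.cast_ne_zero.mpr n.factorial_ne_zero
    have h2 : ((n - j).factorial : ℝ) ≠ 0 := Nat.cast_ne_zero.mpr (n - j).factorial_ne_zero
    have h3 : ((n - j).factorial : ℝ) * n.descFactorial j = n.factorial := by
      exact_mod_cast Nat.factorial_mul_descFactorial hj
    have : (C (c (β + 1) / n.factorial) * (n.descFactorial j •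
        (X - C (1 / (N : ℝ) * (β + 1 : ℕ))) ^ (n - j)) : ℝ[X])
        = C (c (β + 1) / (n - j).factorial) * (X - C (1 / (N : ℝ) * (β + 1 : ℕ))) ^ (n - j) := by
      rw [nsmul_eq_mul, ← C_eq_natCast, ← mul_assoc, ← C_mul]
      congr 2
      rw [← h3]
      have h4 : (n.descFactorial j : ℝ) ≠ 0 := by
        intro h; rw [h, mul_zero] at h3; exact h1 h3.symm
      field_simp
    rw [this]
    ring

theorem splineDeriv_eq {n N : ℕ} (hN : 1 ≤ N) {P : ℕ → ℝ[X]} {c : ℕ → ℝ}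
    (hP : ∀ β < N, P β = P (β + 1)
      + C (c (β + 1) / n.factorial) * (X - C (1 / (N : ℝ) * (β + 1 : ℕ))) ^ n)
    {β : ℕ} (hβ : β < N) {j : ℕ} (hj : j < n) {x : ℝ}
    (hx : x ∈ Icc (1 / (N : ℝ) * β) (1 / (N : ℝ) * (β + 1 : ℕ))) :
    splineDeriv n N (P 0) c j x = (derivative^[j] (P β)).eval x := by
  have hN' : (0 : ℝ) < N := by exact_mod_cast hN
  rw [iterate_derivative_eq_of_jumps hP hβ.le hj.le, splineDeriv, eval_sub, eval_finsetSum]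
  congr 1
  have hsub : Finset.range β ⊆ Finset.range (N - 1) :=
    Finset.range_subset_range.mpr (by omega)
  rw [← Finset.sum_subset hsub]
  · refine Finset.sum_congr rfl fun γ hγ => ?_
    have hle : (1 / (N : ℝ) * (γ + 1 : ℕ)) ≤ x := by
      refine le_trans ?_ hx.1
      have : ((γ + 1 : ℕ) : ℝ) ≤ β := by exact_mod_cast Finset.mem_range.mp hγ
      gcongr
    rw [max_eq_left (by linarith)]
    simp
  · intro γ _ hγ
    have hle : x ≤ (1 / (N : ℝ) * (γ + 1 : ℕ)) := by
      refine hx.2.trans ?_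
      have : ((β + 1 : ℕ) : ℝ) ≤ (γ + 1 : ℕ) := by
        have := Finset.mem_range.not.mp hγ
        exact_mod_cast (by omega)
      gcongr
    rw [max_eq_right (by linarith), zero_pow (by omega), mul_zero]

theorem sum_integral_splineDeriv {m : ℕ} {φ : ℝ → ℝ} (hφ : IsSobolev m φ) {n N : ℕ} (hmn : m < n)
    (hN : 1 ≤ N) {P : ℕ → ℝ[X]} {c : ℕ → ℝ}
    (hP : ∀ β < N, P β = P (β + 1)
      + C (c (β + 1) / n.factorial) * (X - C (1 / (N : ℝ) * (β + 1 : ℕ))) ^ n) :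
    ∑ β ∈ Finset.range N, ∫ x in (1 / (N : ℝ) * β)..(1 / (N : ℝ) * (β + 1 : ℕ)),
        (derivative^[m] (P β)).eval x * iteratedDerivWithin m φ (Icc 0 1) x
      = ∫ x in (0 : ℝ)..1, splineDeriv n N (P 0) c m x * iteratedDerivWithin m φ (Icc 0 1) x := by
  have hN' : (0 : ℝ) < N := by exact_mod_cast hN
  have hle : ∀ β : ℕ, (1 / (N : ℝ) * β) ≤ (1 / (N : ℝ) * (β + 1 : ℕ)) := by
    intro β; gcongr; simp
  have h := intervalIntegral.sum_integral_adjacent_intervals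
    (f := fun x => splineDeriv n N (P 0) c m x * iteratedDerivWithin m φ (Icc 0 1) x) (μ := volume)
    (a := fun β : ℕ => 1 / (N : ℝ) * β) (n := N) (fun k hk => ?_)
  · simp only [Nat.cast_zero, mul_zero] at h
    rw [show 1 / (N : ℝ) * (N : ℝ) = 1 by field_simp] at h
    rw [← h]
    refine Finset.sum_congr rfl fun β hβ => ?_
    refine intervalIntegral.integral_congr fun x hx => ?_
    rw [uIcc_of_le (hle β)] at hx
    simp only [splineDeriv_eq hN hP (Finset.mem_range.mp hβ) hmn hx]
  · refine IntervalIntegrable.continuousOn_mul (hφ.intervalIntegrable (by positivity) (hle k) ?_)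
      (continuous_splineDeriv _ _ _ _ _).continuousOn
    rw [one_div, inv_mul_le_iff₀ hN', mul_one]
    exact_mod_cast hk

end

/-! ### The error functional and the optimality criterion -/

section

theorem sq_integral_mul_le {μ : Measure ℝ} {f g : ℝ → ℝ} (hf : MemLp f 2 μ) (hg : MemLp g 2 μ) :
    (∫ x, f x * g x ∂μ) ^ 2 ≤ (∫ x, f x ^ 2 ∂μ) * ∫ x, g x ^ 2 ∂μ := by
  have hfg : Integrable (fun x => f x * g x) μ := hf.integrable_mul hg
  have h : ∀ t : ℝ, 0 ≤ (∫ x, g x ^ 2 ∂μ) * (t * t) + (2 * ∫ x, f x * g x ∂μ) * t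
      + ∫ x, f x ^ 2 ∂μ := by
    intro t
    have h1 : 0 ≤ ∫ x, (f x + t * g x) ^ 2 ∂μ := integral_nonneg fun x => sq_nonneg _
    have h2 : ∫ x, (f x + t * g x) ^ 2 ∂μ
        = ∫ x, (f x ^ 2 + (2 * t) * (f x * g x)) + (t * t) * g x ^ 2 ∂μ :=
      integral_congr_ae (Filter.Eventually.of_forall fun x => by ring)
    have h3 : Integrable (fun x => f x ^ 2 + (2 * t) * (f x * g x)) μ :=
      hf.integrable_sq.add (hfg.const_mul _)
    rw [h2, integral_add h3 (hg.integrable_sq.const_mul _), integral_add hf.integrable_sq (hfg.const_mul _),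
      integral_const_mul, integral_const_mul] at h1
    linarith
  have := discrim_le_zero h
  rw [discrim] at this
  nlinarith

theorem intervalIntegral_unit (f : ℝ → ℝ) :
    ∫ x in (0 : ℝ)..1, f x = ∫ x in Icc (0 : ℝ) 1, f x := by
  rw [intervalIntegral.integral_of_le zero_le_one, integral_Icc_eq_integral_Ioc]

theorem abs_integral_mul_le {m : ℕ} {φ ψ : ℝ → ℝ} (hφ : IsSobolev m φ) (hψ : IsSobolev m ψ) :
    |∫ x in (0 : ℝ)..1, iteratedDerivWithin m ψ (Icc 0 1) x * iteratedDerivWithin m φ (Icc 0 1) x|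
      ≤ sobolevNorm m ψ * sobolevNorm m φ := by
  rw [sobolevNorm, sobolevNorm, ← Real.sqrt_mul (by
    rw [intervalIntegral_unit]; exact integral_nonneg fun x => sq_nonneg _)]
  refine Real.abs_le_sqrt ?_
  rw [intervalIntegral_unit, intervalIntegral_unit, intervalIntegral_unit]
  exact sq_integral_mul_le hψ.memLp hφ.memLp

variable {m N : ℕ}

/-- The inner product of the derivatives of order `m`. -/
def sobolevInner (m : ℕ) (f g : ℝ → ℝ) : ℝ :=
  ∫ x in (0 : ℝ)..1, iteratedDerivWithin m f (Icc 0 1) x * iteratedDerivWithin m g (Icc 0 1) x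

theorem sobolevNorm_sq (f : ℝ → ℝ) : sobolevNorm m f ^ 2 = sobolevInner m f f := by
  rw [sobolevNorm, Real.sq_sqrt]
  · simp only [sobolevInner, sq]
  · rw [intervalIntegral_unit]; exact integral_nonneg fun x => sq_nonneg _

theorem sobolevNorm_nonneg (f : ℝ → ℝ) : 0 ≤ sobolevNorm m f := Real.sqrt_nonneg _

theorem sobolevInner_comm (f g : ℝ → ℝ) : sobolevInner m f g = sobolevInner m g f := by
  simp only [sobolevInner, mul_comm]

theorem continuousOn_iteratedDerivWithin {f : ℝ → ℝ} (hf : ContDiff ℝ m f) :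
    ContinuousOn (iteratedDerivWithin m f (Icc 0 1)) (Icc 0 1) :=
  hf.contDiffOn.continuousOn_iteratedDerivWithin le_rfl uniqueDiffOn_unit

theorem iteratedDerivWithin_lin {f g : ℝ → ℝ} (hf : ContDiff ℝ m f) (hg : ContDiff ℝ m g) (s t : ℝ)
    {x : ℝ} (hx : x ∈ Icc (0 : ℝ) 1) :
    iteratedDerivWithin m (fun x => s * f x + t * g x) (Icc 0 1) x
      = s * iteratedDerivWithin m f (Icc 0 1) x + t * iteratedDerivWithin m g (Icc 0 1) x := by
  have h1 : ContDiffWithinAt ℝ m f (Icc 0 1) x := hf.contDiffWithinAt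
  have h2 : ContDiffWithinAt ℝ m g (Icc 0 1) x := hg.contDiffWithinAt
  rw [iteratedDerivWithin_fun_add hx uniqueDiffOn_unit (contDiffWithinAt_const.mul h1)
    (contDiffWithinAt_const.mul h2), iteratedDerivWithin_const_mul_field,
    iteratedDerivWithin_const_mul_field]

theorem sobolevInner_lin_left {f g k : ℝ → ℝ} (hf : ContDiff ℝ m f) (hg : ContDiff ℝ m g)
    (hk : ContDiff ℝ m k) (s t : ℝ) :
    sobolevInner m (fun x => s * f x + t * g x) k
      = s * sobolevInner m f k + t * sobolevInner m g k := by
  have cf := continuousOn_iteratedDerivWithin hf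
  have cg := continuousOn_iteratedDerivWithin hg
  have ck := continuousOn_iteratedDerivWithin hk
  rw [← uIcc_of_le (zero_le_one (α := ℝ))] at cf cg ck
  simp only [sobolevInner]
  rw [← intervalIntegral.integral_const_mul, ← intervalIntegral.integral_const_mul,
    ← intervalIntegral.integral_add]
  · refine intervalIntegral.integral_congr fun x hx => ?_
    rw [uIcc_of_le zero_le_one] at hx
    simp only [iteratedDerivWithin_lin hf hg s t hx]
    ring
  · rw [uIcc_of_le zero_le_one] at cf ck
    exact ((cf.mul ck).const_mul s |>.intervalIntegrable_of_Icc zero_le_one)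
  · rw [uIcc_of_le zero_le_one] at cg ck
    exact ((cg.mul ck).const_mul t |>.intervalIntegrable_of_Icc zero_le_one)

theorem sobolevNorm_sq_lin {f g : ℝ → ℝ} (hf : ContDiff ℝ m f) (hg : ContDiff ℝ m g) (s t : ℝ) :
    sobolevNorm m (fun x => s * f x + t * g x) ^ 2
      = s ^ 2 * sobolevNorm m f ^ 2 + 2 * s * t * sobolevInner m f g + t ^ 2 * sobolevNorm m g ^ 2 := by
  have hl : ContDiff ℝ m (fun x => s * f x + t * g x) :=
    (contDiff_const.mul hf).add (contDiff_const.mul hg)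
  rw [sobolevNorm_sq, sobolevInner_lin_left hf hg hl, sobolevInner_comm f, sobolevInner_comm g,
    sobolevInner_lin_left hf hg hf, sobolevInner_lin_left hf hg hg, sobolevNorm_sq, sobolevNorm_sq,
    sobolevInner_comm g f]
  ring

theorem Formula.error_lin (Q : Formula N) {f g : ℝ → ℝ} (hf : ContDiff ℝ 1 f) (hg : ContDiff ℝ 1 g)
    (s t : ℝ) : Q.error (fun x => s * f x + t * g x) = s * Q.error f + t * Q.error g := by
  have hd : ∀ x ∈ Icc (0 : ℝ) 1, derivWithin (fun x => s * f x + t * g x) (Icc 0 1) x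
      = s * derivWithin f (Icc 0 1) x + t * derivWithin g (Icc 0 1) x := by
    intro x hx
    have h1 := ((hf.differentiable one_ne_zero) x).hasDerivAt.hasDerivWithinAt (s := Icc (0 : ℝ) 1)
    have h2 := ((hg.differentiable one_ne_zero) x).hasDerivAt.hasDerivWithinAt (s := Icc (0 : ℝ) 1)
    have hu := uniqueDiffOn_unit x hx
    rw [((h1.const_mul s).fun_add (h2.const_mul t)).derivWithin hu, h1.derivWithin hu,
      h2.derivWithin hu]
  have hi : ∫ x in (0 : ℝ)..1, (s * f x + t * g x)
      = s * (∫ x in (0 : ℝ)..1, f x) + t * ∫ x in (0 : ℝ)..1, g x := by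
    rw [intervalIntegral.integral_add, intervalIntegral.integral_const_mul,
      intervalIntegral.integral_const_mul]
    · exact (hf.continuous.const_mul s).intervalIntegrable _ _
    · exact (hg.continuous.const_mul t).intervalIntegrable _ _
  simp only [Formula.error, hi, hd 0 (by simp), hd 1 (by simp), mul_add, Finset.sum_add_distrib]
  have e : ∀ (u : ℝ) (k : ℝ → ℝ), ∑ β : Fin (N + 1), Q.C β * (u * k (1 / (N : ℝ) * (β : ℕ)))
      = u * ∑ β : Fin (N + 1), Q.C β * k (1 / (N : ℝ) * (β : ℕ)) := by
    intro u k; rw [Finset.mul_sum]; exact Finset.sum_congr rfl fun _ _ => by ring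
  rw [e, e]
  ring

theorem Formula.error_le_of_norm_eq_one {Q : Formula N} {M : ℝ} (hM : 0 ≤ M)
    (hQ : Q.errorNorm m ≤ ENNReal.ofReal M) {f : ℝ → ℝ} (hf : IsSobolev m f)
    (h1 : sobolevNorm m f = 1) : |Q.error f| ≤ M := by
  rw [← ENNReal.ofReal_le_ofReal_iff hM]
  refine le_trans ?_ hQ
  exact le_iSup_of_le f (le_iSup_of_le hf (le_iSup_of_le h1 le_rfl))

/-- The monomial `x^m / m!` has norm one. -/
theorem sobolevNorm_monomial :
    sobolevNorm m (fun x => (C (1 / (m.factorial : ℝ)) * X ^ m : ℝ[X]).eval x) = 1 := by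
  have h : ∀ x ∈ Icc (0 : ℝ) 1, iteratedDerivWithin m
      (fun x => (C (1 / (m.factorial : ℝ)) * X ^ m : ℝ[X]).eval x) (Icc 0 1) x = 1 := by
    intro x hx
    rw [iteratedDerivWithin_of_contDiff (contDiff_polynomial _) le_rfl hx, iteratedDeriv_polynomial,
      iterate_derivative_C_mul, iterate_derivative_X_pow_eq_natCast_mul]
    have : (m.factorial : ℝ) ≠ 0 := Nat.cast_ne_zero.mpr m.factorial_ne_zero
    simp [Nat.descFactorial_self, this]
  rw [sobolevNorm, intervalIntegral.integral_congr (g := fun _ => (1 : ℝ))]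
  · simp
  · intro x hx
    rw [uIcc_of_le zero_le_one] at hx
    simp only [h x hx, one_pow]

/-- A formula whose error functional is bounded satisfies the norm estimate on all smooth
functions; in particular it is exact on the functions of norm zero. -/
theorem Formula.abs_error_le (hm : 1 ≤ m) {Q : Formula N} {M : ℝ} (hM : 0 ≤ M)
    (hQ : Q.errorNorm m ≤ ENNReal.ofReal M) {f : ℝ → ℝ} (hf : ContDiff ℝ m f) :
    |Q.error f| ≤ M * sobolevNorm m f := by
  have h1m : ((1 : ℕ) : WithTop ℕ∞) ≤ (m : ℕ) := by exact_mod_cast hm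
  have hf1 : ContDiff ℝ 1 f := hf.of_le h1m
  set g : ℝ → ℝ := fun x => (Polynomial.C (1 / (m.factorial : ℝ)) * X ^ m : ℝ[X]).eval x with hg
  have hgc : ContDiff ℝ m g := contDiff_polynomial _
  have hg1 : ContDiff ℝ 1 g := contDiff_polynomial _
  have hgn : sobolevNorm m g = 1 := sobolevNorm_monomial
  rcases (sobolevNorm_nonneg (m := m) f).eq_or_lt with h0 | h0
  · -- Adding any multiple of `f` to a function of norm one does not change the norm.
    have hin : sobolevInner m g f = 0 := by
      have := abs_integral_mul_le (isSobolev_of_contDiff hm hf) (isSobolev_of_contDiff hm hgc)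
      rw [← h0, mul_zero] at this
      exact abs_eq_zero.mp (le_antisymm this (abs_nonneg _))
    have hall : ∀ t : ℝ, |Q.error g + t * Q.error f| ≤ M := by
      intro t
      have hc : ContDiff ℝ m (fun x => 1 * g x + t * f x) :=
        (contDiff_const.mul hgc).add (contDiff_const.mul hf)
      have hn : sobolevNorm m (fun x => 1 * g x + t * f x) = 1 := by
        have := sobolevNorm_sq_lin hgc hf 1 t
        rw [hin, ← h0, hgn] at this
        nlinarith [sobolevNorm_nonneg (m := m) (fun x => 1 * g x + t * f x)]
      have := Formula.error_le_of_norm_eq_one hM hQ (isSobolev_of_contDiff hm hc) hn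
      rwa [Q.error_lin hg1 hf1, one_mul] at this
    have he : Q.error f = 0 := by
      by_contra hne
      have h2 := hall ((M + 1 - Q.error g) / Q.error f)
      rw [div_mul_cancel₀ _ hne, abs_le] at h2
      linarith [h2.2]
    rw [he, ← h0, abs_zero, mul_zero]
  · have hc : ContDiff ℝ m (fun x => (sobolevNorm m f)⁻¹ * f x + 0 * f x) :=
      (contDiff_const.mul hf).add (contDiff_const.mul hf)
    have hn : sobolevNorm m (fun x => (sobolevNorm m f)⁻¹ * f x + 0 * f x) = 1 := by
      have h2 := sobolevNorm_sq_lin hf hf (sobolevNorm m f)⁻¹ 0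
      have h3 : (sobolevNorm m f)⁻¹ ^ 2 * sobolevNorm m f ^ 2 = 1 := by
        rw [← mul_pow, inv_mul_cancel₀ h0.ne', one_pow]
      nlinarith [sobolevNorm_nonneg (m := m) (fun x => (sobolevNorm m f)⁻¹ * f x + 0 * f x)]
    have h2 := Formula.error_le_of_norm_eq_one hM hQ (isSobolev_of_contDiff hm hc) hn
    rw [Q.error_lin hf1 hf1, zero_mul, add_zero, abs_mul, abs_inv, abs_of_pos h0,
      inv_mul_le_iff₀ h0] at h2
    linarith

theorem Formula.error_polynomial (Q : Formula N) (p : ℝ[X]) : Q.error (fun x => p.eval x)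
    = (∫ x in (0 : ℝ)..1, p.eval x) - ∑ β : Fin (N + 1), Q.C β * p.eval (1 / (N : ℝ) * (β : ℕ))
      - Q.A * (derivative p).eval 0 - Q.B * (derivative p).eval 1 := by
  have h : ∀ x ∈ Icc (0 : ℝ) 1, derivWithin (fun x => p.eval x) (Icc 0 1) x
      = (derivative p).eval x := fun x hx =>
    (p.hasDerivAt x).hasDerivWithinAt.derivWithin (uniqueDiffOn_unit x hx)
  rw [Formula.error, h 0 (by simp), h 1 (by simp)]

/-- Hermite interpolation: the coefficients of a formula are determined by its values on
polynomials. -/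
theorem Formula.ext_of_polynomial (hN : 1 ≤ N) {Q Q' : Formula N}
    (h : ∀ p : ℝ[X], Q.error (fun x => p.eval x) = Q'.error (fun x => p.eval x)) : Q = Q' := by
  have hN' : (0 : ℝ) < N := by exact_mod_cast hN
  set node : Fin (N + 1) → ℝ := fun β => 1 / (N : ℝ) * (β : ℕ) with hnode
  have hinj : Function.Injective node := by
    intro a b hab
    have : ((a : ℕ) : ℝ) = (b : ℕ) := mul_left_cancel₀ (by positivity) hab
    exact Fin.ext (by exact_mod_cast this)
  have h0 : node 0 = 0 := by simp [hnode]
  have h1 : node (Fin.last N) = 1 := by simp [hnode]; field_simp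
  have hne : (0 : Fin (N + 1)) ≠ Fin.last N := by
    intro h; have := congrArg Fin.val h; simp at this; omega
  have hrel : ∀ p : ℝ[X], ∑ β, (Q.C β - Q'.C β) * p.eval (node β)
      + (Q.A - Q'.A) * (derivative p).eval 0 + (Q.B - Q'.B) * (derivative p).eval 1 = 0 := by
    intro p
    have := h p
    rw [Q.error_polynomial, Q'.error_polynomial] at this
    simp only [sub_mul, Finset.sum_sub_distrib]
    linarith
  -- `R β` vanishes to second order at all nodes but `β`.
  set R : Fin (N + 1) → ℝ[X] := fun β => (∏ γ ∈ Finset.univ.erase β, (X - Polynomial.C (node γ))) ^ 2 with hR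
  have hR0 : ∀ β γ, γ ≠ β → (R β).eval (node γ) = 0 := by
    intro β γ hγ
    simp only [hR, eval_pow, eval_prod]
    rw [Finset.prod_eq_zero (i := γ) (Finset.mem_erase.mpr ⟨hγ, Finset.mem_univ _⟩) (by simp)]
    simp
  have hR1 : ∀ β γ, γ ≠ β → (derivative (R β)).eval (node γ) = 0 := by
    intro β γ hγ
    simp only [hR, derivative_sq, eval_mul, eval_prod]
    rw [Finset.prod_eq_zero (i := γ) (Finset.mem_erase.mpr ⟨hγ, Finset.mem_univ _⟩) (by simp)]
    simp
  have hRne : ∀ β, (R β).eval (node β) ≠ 0 := by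
    intro β
    simp only [hR, eval_pow, eval_prod]
    refine pow_ne_zero 2 (Finset.prod_ne_zero_iff.mpr fun γ hγ => ?_)
    simp only [eval_sub, eval_X, eval_C]
    exact sub_ne_zero.mpr fun he => (Finset.mem_erase.mp hγ).1 (hinj he).symm
  have hA : Q.A - Q'.A = 0 := by
    have := hrel ((X - Polynomial.C (node 0)) * R 0)
    have e := hR1 0 (Fin.last N) hne.symm
    have e' := hR0 0 (Fin.last N) hne.symm
    have e2 := hRne 0
    rw [h1] at e e'
    rw [h0] at e2
    rw [Finset.sum_eq_zero] at this
    · simp only [derivative_mul, derivative_sub, derivative_X, derivative_C, eval_add, eval_mul,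
        eval_sub, eval_X, eval_C, h0, e, e', eval_one, eval_zero] at this
      have : (Q.A - Q'.A) * (R 0).eval 0 = 0 := by linear_combination this
      exact (mul_eq_zero.mp this).resolve_right e2
    · intro γ _
      by_cases hγ : γ = 0
      · rw [hγ]; simp
      · rw [eval_mul, hR0 0 γ hγ]; simp
  have hB : Q.B - Q'.B = 0 := by
    have := hrel ((X - Polynomial.C (node (Fin.last N))) * R (Fin.last N))
    have e := hR1 (Fin.last N) 0 hne
    have e' := hR0 (Fin.last N) 0 hne
    have e2 := hRne (Fin.last N)
    rw [h0] at e e'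
    rw [h1] at e2
    rw [Finset.sum_eq_zero] at this
    · simp only [derivative_mul, derivative_sub, derivative_X, derivative_C, eval_add, eval_mul,
        eval_sub, eval_X, eval_C, h1, e, e', eval_one, eval_zero] at this
      have : (Q.B - Q'.B) * (R (Fin.last N)).eval 1 = 0 := by linear_combination this
      exact (mul_eq_zero.mp this).resolve_right e2
    · intro γ _
      by_cases hγ : γ = Fin.last N
      · rw [hγ]; simp
      · rw [eval_mul, hR0 _ γ hγ]; simp
  have hC : ∀ β, Q.C β - Q'.C β = 0 := by
    intro β
    have := hrel (R β)
    rw [hA, hB, zero_mul, zero_mul, add_zero, add_zero, Finset.sum_eq_single β] at this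
    · exact (mul_eq_zero.mp this).resolve_right (hRne β)
    · intro γ _ hγ; rw [hR0 β γ hγ, mul_zero]
    · intro h; exact absurd (Finset.mem_univ β) h
  cases Q; cases Q'
  simp only [Formula.mk.injEq]
  exact ⟨funext fun β => sub_eq_zero.mp (hC β), sub_eq_zero.mp hA, sub_eq_zero.mp hB⟩

/-- The optimality criterion: if the error functional of `Q` is represented, up to a sign `s`, by
a function `ψ` that vanishes at the nodes together with its derivatives at the end points, then `Q`
is the only optimal formula. The error of `ψ` is `∫ ψ` for every formula, which bounds all error
norms below by the norm of `ψ`. -/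
theorem Formula.isOptimal_of_representer (hm : 1 ≤ m) (hN : 1 ≤ N) {Q : Formula N} {ψ : ℝ → ℝ}
    {s : ℝ} (hs : s * s = 1) (hψ : ContDiff ℝ m ψ) (hpos : 0 < sobolevNorm m ψ)
    (hnode : ∀ β : Fin (N + 1), ψ (1 / (N : ℝ) * (β : ℕ)) = 0)
    (h0 : derivWithin ψ (Icc 0 1) 0 = 0) (h1 : derivWithin ψ (Icc 0 1) 1 = 0)
    (hrep : ∀ φ, IsSobolev m φ → Q.error φ = s * sobolevInner m ψ φ) :
    Q.IsOptimal m ∧ ∀ Q' : Formula N, Q'.IsOptimal m → Q' = Q := by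
  have h1m : ((1 : ℕ) : WithTop ℕ∞) ≤ (m : ℕ) := by exact_mod_cast hm
  have hψ1 : ContDiff ℝ 1 ψ := hψ.of_le h1m
  have hψS := isSobolev_of_contDiff hm hψ
  set κ := sobolevNorm m ψ with hκ
  have hsabs : |s| = 1 := by
    have : |s| * |s| = 1 := by rw [← abs_mul, hs, abs_one]
    nlinarith [abs_nonneg s]
  have hupper : Q.errorNorm m ≤ ENNReal.ofReal κ := by
    refine iSup_le fun φ => iSup_le fun hφ => iSup_le fun hφ1 => ENNReal.ofReal_le_ofReal ?_
    rw [hrep φ hφ, abs_mul, hsabs, one_mul]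
    have := abs_integral_mul_le hφ hψS
    rwa [hφ1, mul_one] at this
  have hall : ∀ Q' : Formula N, Q'.error ψ = s * κ ^ 2 := by
    intro Q'
    have : Q'.error ψ = Q.error ψ := by
      simp only [Formula.error, hnode, h0, h1, mul_zero, Finset.sum_const_zero]
    rw [this, hrep ψ hψS, hκ, sobolevNorm_sq]
  have hlower : ∀ Q' : Formula N, ENNReal.ofReal κ ≤ Q'.errorNorm m := by
    intro Q'
    by_contra! hlt
    obtain ⟨M, hM, hM2⟩ : ∃ M : ℝ, 0 ≤ M ∧ Q'.errorNorm m = ENNReal.ofReal M :=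
      ⟨(Q'.errorNorm m).toReal, ENNReal.toReal_nonneg, (ENNReal.ofReal_toReal hlt.ne_top).symm⟩
    have h2 := Formula.abs_error_le hm hM hM2.le hψ
    rw [hall, abs_mul, hsabs, one_mul, abs_of_nonneg (sq_nonneg _), ← hκ] at h2
    rw [hM2, ENNReal.ofReal_lt_ofReal_iff hpos] at hlt
    nlinarith
  have hopt : Q.IsOptimal m :=
    ⟨ne_top_of_le_ne_top ENNReal.ofReal_ne_top hupper, fun Q' => hupper.trans (hlower Q')⟩
  refine ⟨hopt, fun Q' hQ' => ?_⟩
  have hQ'n : Q'.errorNorm m ≤ ENNReal.ofReal κ := (hQ'.2 Q).trans hupper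
  refine Formula.ext_of_polynomial hN fun p => ?_
  have hp : ContDiff ℝ m (fun x => p.eval x) := contDiff_polynomial p
  have hp1 : ContDiff ℝ 1 (fun x => p.eval x) := contDiff_polynomial p
  rw [hrep _ (isSobolev_of_contDiff hm hp)]
  set e := Q'.error (fun x => p.eval x) with he
  set a := sobolevInner m ψ (fun x => p.eval x) with ha
  set b := sobolevNorm m (fun x => p.eval x) with hb
  -- The norm estimate along the line `ψ + t p` is an equality at `t = 0`, so the derivatives agree.
  have hquad : ∀ t : ℝ, 0 ≤ (κ ^ 2 * b ^ 2 - e ^ 2) * (t * t) + (2 * κ ^ 2 * (a - s * e)) * t + 0 := by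
    intro t
    have hc : ContDiff ℝ m (fun x => 1 * ψ x + t * p.eval x) :=
      (contDiff_const.mul hψ).add (contDiff_const.mul hp)
    have h2 := Formula.abs_error_le hm hpos.le hQ'n hc
    have h3 := sobolevNorm_sq_lin hψ hp 1 t
    rw [Q'.error_lin hψ1 hp1, hall, one_mul] at h2
    have h4 := pow_le_pow_left₀ (abs_nonneg _) h2 2
    rw [sq_abs, mul_pow, h3] at h4
    have h5 : (s * κ ^ 2 + t * e) ^ 2 = κ ^ 4 + 2 * s * κ ^ 2 * t * e + t ^ 2 * e ^ 2 := by
      linear_combination κ ^ 4 * hs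
    rw [← he, h5] at h4
    nlinarith
  have hd := discrim_le_zero hquad
  rw [discrim] at hd
  have h6 : (2 * κ ^ 2 * (a - s * e)) ^ 2 ≤ 0 := by linarith
  have h7 : 2 * κ ^ 2 * (a - s * e) = 0 := pow_eq_zero_iff two_ne_zero |>.mp
    (le_antisymm h6 (sq_nonneg _))
  have h8 : a - s * e = 0 := (mul_eq_zero.mp h7).resolve_left (by positivity)
  linear_combination (-s) * h8 - e * hs

end

/-! ### The spline representing the error functional -/

section

theorem natDegree_lt_of_iterate_derivative {P : ℝ[X]} {m : ℕ} (hm : 1 ≤ m)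
    (h : derivative^[m] P = 0) : P.natDegree < m := by
  have : P.natDegree ≤ m - 1 := by
    rw [natDegree_le_iff_coeff_eq_zero]
    intro n hn
    obtain ⟨i, rfl⟩ : ∃ i, n = i + m := ⟨n - m, by omega⟩
    have h2 := congrArg (fun f => f.coeff i) h
    simp only [coeff_iterate_derivative, coeff_zero, nsmul_eq_mul] at h2
    refine (mul_eq_zero.mp h2).resolve_left (Nat.cast_ne_zero.mpr ?_)
    exact (Nat.descFactorial_pos.mpr (by omega)).ne'
  omega

/-- A polynomial of degree less than `m ≤ N + 3` with simple zeros at the interior nodes and double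
zeros at the end points vanishes. -/
theorem eq_zero_of_nodes {m N : ℕ} (hm : 1 ≤ m) (hN : 1 ≤ N) (hmN : m ≤ N + 3) {P : ℝ[X]}
    (hP : derivative^[m] P = 0) (hnode : ∀ β ≤ N, P.eval (1 / (N : ℝ) * β) = 0)
    (h0 : (derivative P).eval 0 = 0) (h1 : (derivative P).eval 1 = 0) : P = 0 := by
  have hN' : (0 : ℝ) < N := by exact_mod_cast hN
  have hdeg := natDegree_lt_of_iterate_derivative hm hP
  by_contra hne
  have hd : derivative P ≠ 0 := by
    intro hd
    have hc := eq_C_of_derivative_eq_zero hd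
    have h2 := hnode 0 (Nat.zero_le _)
    rw [hc, eval_C] at h2
    rw [h2, C_0] at hc
    exact hne hc
  have hroot : ∀ β ≤ N, 1 / (N : ℝ) * β ∈ P.roots.toFinset := fun β hβ => by
    rw [Multiset.mem_toFinset, mem_roots hne]; exact hnode β hβ
  have hcard : N + 1 ≤ P.roots.toFinset.card := by
    have hinj : Set.InjOn (fun β : ℕ => 1 / (N : ℝ) * β) (Finset.range (N + 1)) := by
      intro a _ b _ hab
      have : (a : ℝ) = b := mul_left_cancel₀ (by positivity) hab
      exact_mod_cast this
    rw [← Finset.card_range (N + 1), ← Finset.card_image_of_injOn hinj]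
    refine Finset.card_le_card fun x hx => ?_
    obtain ⟨β, hβ, rfl⟩ := Finset.mem_image.mp hx
    exact hroot β (Nat.lt_succ_iff.mp (Finset.mem_range.mp hβ))
  have hR := card_roots_toFinset_le_card_roots_derivative_sdiff_roots_succ P
  set D := (derivative P).roots.toFinset \ P.roots.toFinset
  have hmem0 : (0 : ℝ) ∈ P.roots.toFinset := by simpa using hroot 0 (Nat.zero_le _)
  have hmem1 : (1 : ℝ) ∈ P.roots.toFinset := by
    have := hroot N le_rfl
    rwa [show 1 / (N : ℝ) * (N : ℝ) = 1 by field_simp] at this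
  have hsub : insert 0 (insert 1 D) ⊆ (derivative P).roots.toFinset := by
    intro x hx
    simp only [Finset.mem_insert] at hx
    rcases hx with rfl | rfl | hx
    · rw [Multiset.mem_toFinset, mem_roots hd]; exact h0
    · rw [Multiset.mem_toFinset, mem_roots hd]; exact h1
    · exact (Finset.mem_sdiff.mp hx).1
  have hc := Finset.card_le_card hsub
  rw [Finset.card_insert_of_notMem, Finset.card_insert_of_notMem] at hc
  · have h2 := (Multiset.toFinset_card_le (derivative P).roots).trans (card_roots' _)
    have h3 := natDegree_derivative_le P
    omega
  · exact fun h => (Finset.mem_sdiff.mp h).2 hmem1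
  · simp only [Finset.mem_insert, not_or]
    exact ⟨zero_ne_one, fun h => (Finset.mem_sdiff.mp h).2 hmem0⟩

variable {m N : ℕ} {q : Fin (m - 1) → ℝ}

theorem IsInnerRoots.expWeight_eq_zero (hq : IsInnerRoots m q) (d p : Fin (m - 1) → ℝ) (β : ℕ) :
    expWeight N q d p β (2 * m - 1) = 0 := by
  refine Finset.sum_eq_zero fun k _ => ?_
  rw [hq.powerSum_eq_zero, hq.powerSum_inv_eq_zero, mul_zero, mul_zero, add_zero]

/-- The weights of the exponential Euler splines are determined by the Taylor data at `0`. -/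
theorem IsInnerRoots.eq_zero_of_expWeight (hq : IsInnerRoots m q) {d p : Fin (m - 1) → ℝ}
    (h : ∀ n ≤ 2 * m - 2, expWeight N q d p 0 n = 0) : d = 0 ∧ p = 0 := by
  have hinv : ∀ k, 1 < |(q k)⁻¹| := fun k => by
    rw [abs_inv]; exact (one_lt_inv₀ (abs_pos.mpr (hq.ne_zero k))).mpr (hq.abs_lt_one k)
  have key := powerSum_linearIndependent (ι := Fin (m - 1) ⊕ Fin (m - 1))
    (Sum.elim (fun k => (q k)⁻¹) q) (Sum.elim d fun k => p k * q k ^ N) ?_ ?_ (n := 2 * m - 2) ?_ ?_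
  · constructor
    · funext k; exact congrFun key (Sum.inl k)
    · funext k
      have := congrFun key (Sum.inr k)
      exact (mul_eq_zero.mp this).resolve_right (pow_ne_zero _ (hq.ne_zero k))
  · rintro (a | a) (b | b) hab
    · exact congrArg _ (hq.1 (inv_injective hab))
    · simp only [Sum.elim_inl, Sum.elim_inr] at hab
      have := hinv a
      rw [hab] at this
      exact absurd this (hq.abs_lt_one b).le.not_gt
    · simp only [Sum.elim_inl, Sum.elim_inr] at hab
      have := hinv b
      rw [← hab] at this
      exact absurd this (hq.abs_lt_one a).le.not_gt
    · exact congrArg _ (hq.1 hab)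
  · rintro (a | a)
    · exact hq.inv_ne_one a
    · exact hq.ne_one a
  · simp; omega
  · intro l hl
    have := h l hl
    simp only [expWeight, pow_zero, mul_one, Nat.sub_zero, Finset.sum_add_distrib] at this
    simpa [Fintype.sum_sum_type] using this

/-- The spline `κ · (Bernoulli monospline) + ∑_k (exponential Euler splines)` on `[0,1]`: it
vanishes at the nodes, and its derivative of order `2m` is `κ` between them. -/
def spline (m N : ℕ) (κ : ℝ) (q d p : Fin (m - 1) → ℝ) : ℝ → ℝ :=
  splineDeriv (2 * m - 1) N (splinePoly m N κ q d p 0)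
    (fun β => 1 / (N : ℝ) * splineJump N κ q d p β) 0

theorem contDiff_spline (hm : 2 ≤ m) (κ : ℝ) (d p : Fin (m - 1) → ℝ) :
    ContDiff ℝ m (spline m N κ q d p) :=
  (contDiff_splineDeriv _ _ _ _).of_le (by exact_mod_cast (by omega : m ≤ 2 * m - 1 - 1))

theorem isSobolev_spline (hm : 2 ≤ m) (κ : ℝ) (d p : Fin (m - 1) → ℝ) :
    IsSobolev m (spline m N κ q d p) :=
  isSobolev_of_contDiff (by omega) (contDiff_spline hm κ d p)

theorem IsInnerRoots.splinePoly_eq_succ (hq : IsInnerRoots m q) (hm : 2 ≤ m) (hN : 1 ≤ N) (κ : ℝ)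
    (d p : Fin (m - 1) → ℝ) : ∀ β < N, splinePoly m N κ q d p β = splinePoly m N κ q d p (β + 1)
      + C (1 / (N : ℝ) * splineJump N κ q d p (β + 1) / (2 * m - 1).factorial)
        * (X - C (1 / (N : ℝ) * (β + 1 : ℕ))) ^ (2 * m - 1) := fun _ hβ =>
  OptQuad.splinePoly_eq_succ m κ q d p (by omega) hN hq.ne_zero hq.ne_one hβ

theorem iteratedDerivWithin_spline (hm : 2 ≤ m) (κ : ℝ) (d p : Fin (m - 1) → ℝ) {j : ℕ}
    (hj : j ≤ m) {x : ℝ} (hx : x ∈ Icc (0 : ℝ) 1) :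
    iteratedDerivWithin j (spline m N κ q d p) (Icc 0 1) x
      = splineDeriv (2 * m - 1) N (splinePoly m N κ q d p 0)
          (fun β => 1 / (N : ℝ) * splineJump N κ q d p β) j x := by
  rw [iteratedDerivWithin_of_contDiff (contDiff_spline hm κ d p) hj hx, spline,
    iteratedDeriv_splineDeriv _ _ _ _ (by omega)]

theorem node_mem_unit (hN : 1 ≤ N) {β : ℕ} (hβ : β ≤ N) : 1 / (N : ℝ) * β ∈ Icc (0 : ℝ) 1 := by
  have hN' : (0 : ℝ) < N := by exact_mod_cast hN
  refine ⟨by positivity, ?_⟩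
  rw [one_div, inv_mul_le_iff₀ hN', mul_one]
  exact_mod_cast hβ

/-- At a node, the derivatives of the spline are those of the polynomial to the right of it. -/
theorem IsInnerRoots.iteratedDerivWithin_spline_node (hq : IsInnerRoots m q) (hm : 2 ≤ m)
    (hN : 1 ≤ N) (κ : ℝ) (d p : Fin (m - 1) → ℝ) {j : ℕ} (hj : j ≤ m) {β : ℕ} (hβ : β ≤ N) :
    iteratedDerivWithin j (spline m N κ q d p) (Icc 0 1) (1 / (N : ℝ) * β)
      = (derivative^[j] (splinePoly m N κ q d p β)).eval (1 / (N : ℝ) * β) := by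
  have hle : ∀ β : ℕ, (1 / (N : ℝ) * β) ≤ (1 / (N : ℝ) * (β + 1 : ℕ)) := by
    intro β; gcongr; simp
  rw [iteratedDerivWithin_spline hm κ d p hj (node_mem_unit hN hβ)]
  have hP := hq.splinePoly_eq_succ hm hN κ d p
  rcases Nat.lt_or_ge β N with h | h
  · exact splineDeriv_eq hN (P := splinePoly m N κ q d p)
      (c := fun β => 1 / (N : ℝ) * splineJump N κ q d p β) hP h (by omega) ⟨le_rfl, hle β⟩
  · obtain ⟨γ, rfl⟩ : ∃ γ, β = γ + 1 := ⟨β - 1, by omega⟩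
    rw [splineDeriv_eq hN (P := splinePoly m N κ q d p)
      (c := fun β => 1 / (N : ℝ) * splineJump N κ q d p β) hP (β := γ) (by omega) (by omega)
      ⟨hle γ, le_rfl⟩, hP γ (by omega), iterate_map_add, iterate_derivative_C_mul,
      iterate_derivative_X_sub_pow]
    have : 2 * m - 1 - j ≠ 0 := by omega
    simp [this]

theorem IsInnerRoots.spline_node (hq : IsInnerRoots m q) (hm : 2 ≤ m) (hN : 1 ≤ N) (κ : ℝ)
    (d p : Fin (m - 1) → ℝ) {β : ℕ} (hβ : β ≤ N) : spline m N κ q d p (1 / (N : ℝ) * β) = 0 := by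
  have h := hq.iteratedDerivWithin_spline_node hm hN κ d p (Nat.zero_le m) hβ
  rw [iteratedDerivWithin_zero] at h
  rw [h]
  exact eval_splinePoly m κ q d p (by omega) hN (hq.expWeight_eq_zero d p) β

theorem IsInnerRoots.iteratedDerivWithin_spline_eq (hq : IsInnerRoots m q) (hm : 2 ≤ m)
    (hN : 1 ≤ N) (κ : ℝ) (d p : Fin (m - 1) → ℝ) {n : ℕ} (hn : n < 2 * m) (hmn : m ≤ n)
    {β : ℕ} (hβ : β ≤ N) :
    iteratedDerivWithin (2 * m - n) (spline m N κ q d p) (Icc 0 1) (1 / (N : ℝ) * β)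
      = (1 / (N : ℝ)) ^ n * splineSeq N κ q d p β n / n.factorial := by
  rw [hq.iteratedDerivWithin_spline_node hm hN κ d p (by omega) hβ,
    eval_iterate_derivative_splinePoly m κ q d p hN β hn]

/-- Green's formula for the spline. -/
theorem IsInnerRoots.green (hq : IsInnerRoots m q) (hm : 2 ≤ m) (hN : 1 ≤ N) (κ : ℝ)
    (d p : Fin (m - 1) → ℝ) {φ : ℝ → ℝ} (hφ : IsSobolev m φ) :
    (-1) ^ m * sobolevInner m (spline m N κ q d p) φ
      = κ * (∫ x in (0 : ℝ)..1, φ x)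
        - ∑ β ∈ Finset.range N, 1 / (N : ℝ) * splineJump N κ q d p (β + 1)
            * φ (1 / (N : ℝ) * (β + 1 : ℕ))
        + ∑ j ∈ Finset.range m, (-1) ^ (j + 1) * ((1 / (N : ℝ)) ^ (j + 1) / (j + 1).factorial)
          * (splineSeq N κ q d p N (j + 1) * iteratedDerivWithin j φ (Icc 0 1) 1
          - splineSeq N κ q d p 0 (j + 1) * iteratedDerivWithin j φ (Icc 0 1) 0) := by
  have hN' : (N : ℝ) ≠ 0 := by positivity
  have hP := hq.splinePoly_eq_succ hm hN κ d p
  have h := hφ.green (by omega) hN (splinePoly m N κ q d p)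
    (fun β => 1 / (N : ℝ) * splineJump N κ q d p β) κ hP
    (iterate_derivative_splinePoly_top m κ q d p (by omega) hN)
  rw [sum_integral_splineDeriv hφ (by omega) hN (P := splinePoly m N κ q d p)
    (c := fun β => 1 / (N : ℝ) * splineJump N κ q d p β) hP] at h
  have hin : sobolevInner m (spline m N κ q d p) φ
      = ∫ x in (0 : ℝ)..1, splineDeriv (2 * m - 1) N (splinePoly m N κ q d p 0)
          (fun β => 1 / (N : ℝ) * splineJump N κ q d p β) m x
          * iteratedDerivWithin m φ (Icc 0 1) x := by
    refine intervalIntegral.integral_congr fun x hx => ?_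
    rw [uIcc_of_le zero_le_one] at hx
    simp only [iteratedDerivWithin_spline hm κ d p le_rfl hx]
  rw [hin, h]
  congr 1
  refine Finset.sum_congr rfl fun j hj => ?_
  have hj := Finset.mem_range.mp hj
  have e1 := eval_iterate_derivative_splinePoly m κ q d p hN N (n := j + 1) (by omega)
  have e0 := eval_iterate_derivative_splinePoly m κ q d p hN 0 (n := j + 1) (by omega)
  rw [show 1 / (N : ℝ) * (N : ℝ) = 1 by field_simp] at e1
  rw [Nat.cast_zero, mul_zero] at e0
  rw [show 2 * m - 1 - j = 2 * m - (j + 1) by omega, e1, e0]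
  ring

/-- The positive weights in Green's formula for two splines. -/
def greenCoeff (m N i : ℕ) : ℝ :=
  (1 / (N : ℝ)) ^ (2 * m + 1) / ((i + 1).factorial * (2 * m - 2 - i).factorial)

theorem greenCoeff_ne_zero (hN : 1 ≤ N) (i : ℕ) : greenCoeff m N i ≠ 0 := by
  have hN' : (0 : ℝ) < N := by exact_mod_cast hN
  unfold greenCoeff
  positivity

/-- Green's formula for two splines: the form pairs the Taylor data of order `j` of the first with
those of order `2m - 1 - j` of the second, for `1 ≤ j ≤ m - 1`. -/
theorem IsInnerRoots.green_spline (hq : IsInnerRoots m q) (hm : 2 ≤ m) (hN : 1 ≤ N) (κ : ℝ)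
    (d p d' p' : Fin (m - 1) → ℝ) :
    (-1) ^ m * sobolevInner m (spline m N κ q d p) (spline m N 0 q d' p')
      = κ * (∫ x in (0 : ℝ)..1, spline m N 0 q d' p' x)
        + ∑ i ∈ Finset.range (m - 1), (-1) ^ i * greenCoeff m N i
          * ((expWeight N q d p N (i + 1) - κ * (bernoulli (i + 2) : ℝ) / (i + 2))
              * expWeight N q d' p' N (2 * m - 2 - i)
            - (expWeight N q d p 0 (i + 1) - κ * (bernoulli (i + 2) : ℝ) / (i + 2))
              * expWeight N q d' p' 0 (2 * m - 2 - i)) := by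
  have hN' : (N : ℝ) ≠ 0 := by positivity
  have hone : 1 / (N : ℝ) * (N : ℝ) = 1 := by field_simp
  have hn0 : spline m N 0 q d' p' 0 = 0 := by
    have := hq.spline_node hm hN 0 d' p' (Nat.zero_le N)
    rwa [Nat.cast_zero, mul_zero] at this
  have hn1 : spline m N 0 q d' p' 1 = 0 := by
    have := hq.spline_node hm hN 0 d' p' (le_refl N)
    rwa [hone] at this
  rw [hq.green hm hN κ d p (isSobolev_spline hm 0 d' p'), Finset.sum_eq_zero (s := Finset.range N),
    sub_zero]
  swap
  · intro β hβ
    rw [hq.spline_node hm hN 0 d' p' (Finset.mem_range.mp hβ), mul_zero]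
  congr 1
  rw [show Finset.range m = Finset.range (m - 1 + 1) by congr 1; omega, Finset.sum_range_succ',
    iteratedDerivWithin_zero, hn0, hn1]
  simp only [mul_zero, sub_zero, add_zero]
  refine Finset.sum_congr rfl fun i hi => ?_
  have hi := Finset.mem_range.mp hi
  have hD : ∀ β ≤ N, iteratedDerivWithin (i + 1) (spline m N 0 q d' p') (Icc 0 1)
      (1 / (N : ℝ) * β) = -(1 / (N : ℝ)) ^ (2 * m - (i + 1))
        * expWeight N q d' p' β (2 * m - 2 - i) / (2 * m - 2 - i).factorial := by
    intro β hβ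
    have h := hq.iteratedDerivWithin_spline_eq hm hN 0 d' p'
      (n := 2 * m - (i + 1)) (by omega) (by omega) hβ
    rw [show 2 * m - (2 * m - (i + 1)) = i + 1 by omega] at h
    rw [h]
    obtain ⟨l, hl⟩ : ∃ l, 2 * m - (i + 1) = l + 1 := ⟨2 * m - 2 - i, by omega⟩
    rw [hl, show 2 * m - 2 - i = l by omega, splineSeq, Nat.factorial_succ]
    have : (l.factorial : ℝ) ≠ 0 := Nat.cast_ne_zero.mpr l.factorial_ne_zero
    push_cast
    field_simp
    ring
  have h1 := hD N le_rfl
  have h0 := hD 0 (Nat.zero_le N)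
  rw [hone] at h1
  rw [Nat.cast_zero, mul_zero] at h0
  have hp : (1 / (N : ℝ)) ^ (2 * m + 1)
      = (1 / (N : ℝ)) ^ (i + 1 + 1) * (1 / (N : ℝ)) ^ (2 * m - (i + 1)) := by
    rw [← pow_add]; congr 1; omega
  rw [h0, h1, greenCoeff, splineSeq, splineSeq, hp, Nat.factorial_succ (i + 1)]
  generalize (1 / (N : ℝ)) ^ (2 * m - (i + 1)) = u
  generalize (1 / (N : ℝ)) ^ (i + 1 + 1) = v
  generalize expWeight N q d p N (i + 1) = w1
  generalize expWeight N q d p 0 (i + 1) = w0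
  generalize expWeight N q d' p' N (2 * m - 2 - i) = y1
  generalize expWeight N q d' p' 0 (2 * m - 2 - i) = y0
  have f1 : ((2 * m - 2 - i).factorial : ℝ) ≠ 0 :=
    Nat.cast_ne_zero.mpr (Nat.factorial_ne_zero _)
  have f2 : ((i + 1).factorial : ℝ) ≠ 0 := Nat.cast_ne_zero.mpr (Nat.factorial_ne_zero _)
  have f3 : (i : ℝ) + 2 ≠ 0 := by positivity
  have f4 : (i : ℝ) + 1 + 1 ≠ 0 := by positivity
  generalize ((2 * m - 2 - i).factorial : ℝ) = a at f1 ⊢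
  push_cast
  generalize ((i + 1).factorial : ℝ) = b at f2 ⊢
  rw [show (i : ℝ) + 1 + 1 = i + 2 by ring, show i + 1 + 1 = i + 2 from rfl, pow_add]
  field_simp
  ring

/-- A spline of norm zero is a polynomial of degree less than `m`. -/
theorem IsInnerRoots.iterate_derivative_splinePoly_eq_zero (hq : IsInnerRoots m q) (hm : 2 ≤ m)
    (hN : 1 ≤ N) (κ : ℝ) (d p : Fin (m - 1) → ℝ)
    (h : sobolevInner m (spline m N κ q d p) (spline m N κ q d p) = 0) {β : ℕ} (hβ : β < N) :
    derivative^[m] (splinePoly m N κ q d p β) = 0 := by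
  have hN' : (0 : ℝ) < N := by exact_mod_cast hN
  have hlt : (1 / (N : ℝ) * β) < (1 / (N : ℝ) * (β + 1 : ℕ)) := by
    gcongr; simp
  have hzero : ∀ x ∈ Icc (0 : ℝ) 1,
      iteratedDerivWithin m (spline m N κ q d p) (Icc 0 1) x = 0 := by
    intro x hx
    by_contra hne
    have hc := continuousOn_iteratedDerivWithin (contDiff_spline (N := N) (q := q) hm κ d p)
    have := intervalIntegral.integral_pos zero_lt_one (hc.mul hc)
      (fun y _ => mul_self_nonneg _) ⟨x, hx, mul_self_pos.mpr hne⟩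
    exact this.ne' h
  refine eq_zero_of_infinite_isRoot _ ((Icc_infinite hlt).mono fun x hx => ?_)
  have hx1 : x ∈ Icc (0 : ℝ) 1 :=
    ⟨(node_mem_unit hN hβ.le).1.trans hx.1, hx.2.trans (node_mem_unit hN hβ).2⟩
  have h2 := hzero x hx1
  rw [iteratedDerivWithin_spline hm κ d p le_rfl hx1,
    splineDeriv_eq hN (P := splinePoly m N κ q d p)
      (c := fun β => 1 / (N : ℝ) * splineJump N κ q d p β)
      (hq.splinePoly_eq_succ hm hN κ d p) hβ (by omega) hx] at h2
  exact h2

theorem IsInnerRoots.spline_eq_polynomial (hq : IsInnerRoots m q) (hm : 2 ≤ m)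
    (hN : 1 ≤ N) (κ : ℝ) (d p : Fin (m - 1) → ℝ)
    (h : sobolevInner m (spline m N κ q d p) (spline m N κ q d p) = 0) :
    spline m N κ q d p = fun x => (splinePoly m N κ q d p 0).eval x := by
  have hz := fun β (hβ : β < N) => hq.iterate_derivative_splinePoly_eq_zero hm hN κ d p h hβ
  funext x
  rw [spline, splineDeriv, Function.iterate_zero, id, Finset.sum_eq_zero, sub_zero]
  intro γ hγ
  have hγ : γ < N - 1 := Finset.mem_range.mp hγ
  have h1 := congrArg (derivative^[2 * m - 1]) (hq.splinePoly_eq_succ hm hN κ d p γ (by omega))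
  have hz' : ∀ β < N, derivative^[2 * m - 1] (splinePoly m N κ q d p β) = 0 := by
    intro β hβ
    rw [show 2 * m - 1 = (m - 1) + m by omega, Function.iterate_add_apply, hz β hβ,
      iterate_derivative_zero]
  rw [iterate_map_add, hz' γ (by omega), hz' (γ + 1) (by omega), iterate_derivative_C_mul,
    iterate_derivative_X_sub_pow_self, zero_add] at h1
  have h2 := congrArg (eval 0) h1
  have hf : ((2 * m - 1).factorial : ℝ) ≠ 0 := Nat.cast_ne_zero.mpr (Nat.factorial_ne_zero _)
  simp only [eval_mul, eval_C, eval_natCast, eval_zero] at h2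
  rw [div_mul_cancel₀ _ hf] at h2
  rw [← h2]
  simp

end

/-! ### The linear system and the explicit coefficients -/

section

variable {m N : ℕ} {q : Fin (m - 1) → ℝ}

theorem IsInnerRoots.left_sum (hq : IsInnerRoots m q) (d p : Fin (m - 1) → ℝ) (j : ℕ) :
    ∑ k, ∑ i ∈ Finset.range (j + 1),
      (d k * q k + p k * q k ^ (N + i) * (-1) ^ (i + 1)) / (q k - 1) ^ (i + 1) * diffZero i j
      = expWeight N q d p 0 j := by
  refine Finset.sum_congr rfl fun k _ => ?_
  rw [powerSum_inv_eq_sum j (hq.ne_zero k) (hq.ne_one k), powerSum_eq_sum j (hq.ne_one k),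
    Finset.mul_sum, Finset.mul_sum, ← Finset.sum_add_distrib]
  refine Finset.sum_congr rfl fun i _ => ?_
  rw [pow_zero, Nat.sub_zero, pow_add (q k) N i]
  ring

theorem IsInnerRoots.expWeight_right (hq : IsInnerRoots m q) (d p : Fin (m - 1) → ℝ) (l : ℕ) :
    ∑ k, (d k * q k ^ N * powerSum (l + 1) (q k) + p k * powerSum (l + 1) (q k)⁻¹)
      = (-1) ^ l * expWeight N q d p N (l + 1) := by
  rw [expWeight, Finset.mul_sum]
  refine Finset.sum_congr rfl fun k _ => ?_
  have hs : ((-1 : ℝ) ^ l) * (-1) ^ l = 1 := by rw [← mul_pow]; simp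
  rw [powerSum_inv l (hq.ne_zero k) (hq.ne_one k), Nat.sub_self, pow_zero]
  linear_combination (-(d k * q k ^ N * powerSum (l + 1) (q k))) * hs

theorem IsInnerRoots.right_top_sum (hq : IsInnerRoots m q) (d p : Fin (m - 1) → ℝ) (l : ℕ) :
    ∑ k, ∑ i ∈ Finset.range (l + 1 + 1),
      ((-1) ^ (i + 1) * d k * q k ^ (N + i) + p k * q k) / (q k - 1) ^ (i + 1) * diffZero i (l + 1)
      = (-1) ^ l * expWeight N q d p N (l + 1) := by
  rw [← hq.expWeight_right]
  refine Finset.sum_congr rfl fun k _ => ?_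
  rw [powerSum_inv_eq_sum _ (hq.ne_zero k) (hq.ne_one k), powerSum_eq_sum _ (hq.ne_one k),
    Finset.mul_sum, Finset.mul_sum, ← Finset.sum_add_distrib]
  refine Finset.sum_congr rfl fun i _ => ?_
  rw [pow_add (q k) N i]
  ring

theorem IsInnerRoots.right_low_sum (hq : IsInnerRoots m q) (d p : Fin (m - 1) → ℝ) (l : ℕ) :
    ∑ k, ∑ i ∈ Finset.range (l + 1 + 1),
      (1 - q k ^ N) * (((-1) ^ (i + 1) * d k * q k ^ i - p k * q k) / (q k - 1) ^ (i + 1))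
        * diffZero i (l + 1)
      = (-1) ^ l * (expWeight N q d p 0 (l + 1) - expWeight N q d p N (l + 1)) := by
  rw [mul_sub, ← hq.expWeight_right, expWeight, Finset.mul_sum, ← Finset.sum_sub_distrib]
  refine Finset.sum_congr rfl fun k _ => ?_
  have h1 : ∑ i ∈ Finset.range (l + 1 + 1),
      (1 - q k ^ N) * (((-1) ^ (i + 1) * d k * q k ^ i - p k * q k) / (q k - 1) ^ (i + 1))
        * diffZero i (l + 1)
      = (1 - q k ^ N) * (d k * powerSum (l + 1) (q k) - p k * powerSum (l + 1) (q k)⁻¹) := by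
    rw [powerSum_inv_eq_sum _ (hq.ne_zero k) (hq.ne_one k), powerSum_eq_sum _ (hq.ne_one k),
      Finset.mul_sum, Finset.mul_sum, ← Finset.sum_sub_distrib, Finset.mul_sum]
    refine Finset.sum_congr rfl fun i _ => ?_
    ring
  have hs : ((-1 : ℝ) ^ l) * (-1) ^ l = 1 := by rw [← mul_pow]; simp
  rw [h1, powerSum_inv l (hq.ne_zero k) (hq.ne_one k), pow_zero, Nat.sub_zero]
  linear_combination (-(d k * powerSum (l + 1) (q k))) * hs

/-- The system states that the spline has, at both end points, vanishing derivatives of order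
`m, …, 2m - 3` and of order one. -/
theorem IsInnerRoots.isSolution_iff (hq : IsInnerRoots m q) (hm : 2 ≤ m) {d p : Fin (m - 1) → ℝ} :
    IsSolution m N q d p ↔
      (∀ j : ℕ, 2 ≤ j → j ≤ m - 1 →
        expWeight N q d p 0 j = (bernoulli (j + 1) : ℝ) / ((j : ℝ) + 1) ∧
        expWeight N q d p N j = (bernoulli (j + 1) : ℝ) / ((j : ℝ) + 1)) ∧
      expWeight N q d p 0 (2 * m - 2) = 0 ∧ expWeight N q d p N (2 * m - 2) = 0 := by
  have hsgn : ∀ (l : ℕ) (x : ℝ), (-1) ^ l * x = 0 ↔ x = 0 := fun l x => by simp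
  have htop : 2 * m - 2 = (2 * m - 3) + 1 := by omega
  constructor
  · intro h
    have hl := h.left_low
    have hr := h.right_low
    simp only [hq.left_sum] at hl
    have hlt := h.left_top
    have hrt := h.right_top
    rw [hq.left_sum] at hlt
    rw [htop, hq.right_top_sum, hsgn, ← htop] at hrt
    refine ⟨fun j h2 hj => ⟨hl j h2 hj, ?_⟩, hlt, hrt⟩
    have h3 := hr j h2 hj
    obtain ⟨l, rfl⟩ : ∃ l, j = l + 1 := ⟨j - 1, by omega⟩
    rw [hq.right_low_sum, hsgn] at h3
    rw [← hl _ h2 hj]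
    linarith
  · rintro ⟨h, h0, h1⟩
    refine ⟨fun j h2 hj => ?_, ?_, fun j h2 hj => ?_, ?_⟩
    · rw [hq.left_sum]; exact (h j h2 hj).1
    · rw [hq.left_sum]; exact h0
    · obtain ⟨l, rfl⟩ : ∃ l, j = l + 1 := ⟨j - 1, by omega⟩
      rw [hq.right_low_sum, hsgn, (h _ h2 hj).1, (h _ h2 hj).2, sub_self]
    · rw [htop, hq.right_top_sum, hsgn, ← htop]; exact h1

theorem IsInnerRoots.error_explicitFormula (hq : IsInnerRoots m q) (hN : 1 ≤ N)
    (d p : Fin (m - 1) → ℝ) (φ : ℝ → ℝ) :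
    (explicitFormula m N q d p).error φ = (∫ x in (0 : ℝ)..1, φ x)
      - ∑ β ∈ Finset.range N, 1 / (N : ℝ) * splineJump N 1 q d p (β + 1)
            * φ (1 / (N : ℝ) * (β + 1 : ℕ))
      - 1 / (N : ℝ) * (splineSeq N 1 q d p N 1 * φ 1 - splineSeq N 1 q d p 0 1 * φ 0)
      + (1 / (N : ℝ)) ^ 2 / 2 * (splineSeq N 1 q d p N 2 * derivWithin φ (Icc 0 1) 1
        - splineSeq N 1 q d p 0 2 * derivWithin φ (Icc 0 1) 0) := by
  have hN' : (N : ℝ) ≠ 0 := by positivity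
  have hone : 1 / (N : ℝ) * (N : ℝ) = 1 := by field_simp
  have hne : ∀ k, 1 - q k ≠ 0 := fun k => sub_ne_zero.mpr (hq.ne_one k).symm
  have hinv : ∀ k, 1 / (1 - (q k)⁻¹) = -q k / (1 - q k) := fun k => by
    have h0 := hq.ne_zero k
    have h1 := hne k
    have h2 : q k - 1 ≠ 0 := sub_ne_zero.mpr (hq.ne_one k)
    rw [show 1 - (q k)⁻¹ = (q k - 1) / q k by field_simp, one_div_div]
    field_simp
    ring
  -- The coefficient functions at the end points are one-sided jumps.
  have hC0 : 1 / (N : ℝ) * (1 / 2 + ∑ k, (p k * q k ^ N - d k * q k) / (1 - q k))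
      = -(1 / (N : ℝ)) * splineSeq N 1 q d p 0 1 := by
    have : expWeight N q d p 0 0 = ∑ k, (p k * q k ^ N - d k * q k) / (1 - q k) := by
      refine Finset.sum_congr rfl fun k _ => ?_
      rw [powerSum_zero, powerSum_zero, hinv, pow_zero, Nat.sub_zero]
      ring
    rw [splineSeq, this, zero_add, _root_.bernoulli_one]
    push_cast
    ring
  have hCN : 1 / (N : ℝ) * (1 / 2 + ∑ k, (d k * q k ^ N - p k * q k) / (1 - q k))
      = 1 / (N : ℝ) * splineJump N 1 q d p N + 1 / (N : ℝ) * splineSeq N 1 q d p N 1 := by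
    have : ∑ k, (d k * q k ^ N - p k * q k) / (1 - q k)
        = ∑ k, (d k * q k ^ N + p k * q k ^ (N - N)) - expWeight N q d p N 0 := by
      rw [expWeight, ← Finset.sum_sub_distrib]
      refine Finset.sum_congr rfl fun k _ => ?_
      rw [powerSum_zero, powerSum_zero, hinv, Nat.sub_self, pow_zero]
      have := hne k
      field_simp
      ring
    rw [splineSeq, splineJump, this, zero_add, _root_.bernoulli_one]
    push_cast
    ring
  have hA : (1 / (N : ℝ)) ^ 2 * (1 / 12 - ∑ k, (d k * q k + p k * q k ^ (N + 1)) / (1 - q k) ^ 2)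
      = (1 / (N : ℝ)) ^ 2 / 2 * splineSeq N 1 q d p 0 2 := by
    have : expWeight N q d p 0 1 = ∑ k, (d k * q k + p k * q k ^ (N + 1)) / (1 - q k) ^ 2 := by
      refine Finset.sum_congr rfl fun k _ => ?_
      rw [powerSum_inv 0 (hq.ne_zero k) (hq.ne_one k), powerSum_one (hq.ne_one k), pow_zero,
        Nat.sub_zero, pow_succ]
      ring
    rw [splineSeq, this, bernoulli_two]
    push_cast
    ring
  have hB : (1 / (N : ℝ)) ^ 2 * (-(1 / 12) + ∑ k, (d k * q k ^ (N + 1) + p k * q k) / (1 - q k) ^ 2)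
      = -((1 / (N : ℝ)) ^ 2 / 2) * splineSeq N 1 q d p N 2 := by
    have : expWeight N q d p N 1 = ∑ k, (d k * q k ^ (N + 1) + p k * q k) / (1 - q k) ^ 2 := by
      refine Finset.sum_congr rfl fun k _ => ?_
      rw [powerSum_inv 0 (hq.ne_zero k) (hq.ne_one k), powerSum_one (hq.ne_one k), pow_zero,
        Nat.sub_self, pow_succ]
      ring
    rw [splineSeq, this, bernoulli_two]
    push_cast
    ring
  have hsum : ∑ β : Fin (N + 1), (explicitFormula m N q d p).C β * φ (1 / (N : ℝ) * (β : ℕ))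
      = ∑ β ∈ Finset.range N, 1 / (N : ℝ) * splineJump N 1 q d p (β + 1)
            * φ (1 / (N : ℝ) * (β + 1 : ℕ))
        + 1 / (N : ℝ) * splineSeq N 1 q d p N 1 * φ 1
        - 1 / (N : ℝ) * splineSeq N 1 q d p 0 1 * φ 0 := by
    rw [Fin.sum_univ_succ]
    have e0 : (explicitFormula m N q d p).C 0 * φ (1 / (N : ℝ) * ((0 : Fin (N + 1)) : ℕ))
        = -(1 / (N : ℝ)) * splineSeq N 1 q d p 0 1 * φ 0 := by
      rw [← hC0]; simp [explicitFormula]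
    have e1 : ∀ β : Fin N, (explicitFormula m N q d p).C β.succ * φ (1 / (N : ℝ) * (β.succ : ℕ))
        = 1 / (N : ℝ) * splineJump N 1 q d p ((β : ℕ) + 1) * φ (1 / (N : ℝ) * ((β : ℕ) + 1 : ℕ))
          + if (β : ℕ) = N - 1 then 1 / (N : ℝ) * splineSeq N 1 q d p N 1 * φ 1 else 0 := by
      intro β
      by_cases hβ : (β : ℕ) = N - 1
      · have hβ' : (β : ℕ) + 1 = N := by omega
        simp only [explicitFormula, Fin.val_succ, hβ', if_pos hβ, if_true]
        rw [if_neg (by omega), hCN, hone]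
        ring
      · have hβ' : (β : ℕ) + 1 ≠ N := by omega
        simp only [explicitFormula, Fin.val_succ, if_neg hβ, if_neg hβ', splineJump]
        rw [if_neg (by omega), add_zero]
    rw [e0, Finset.sum_congr rfl fun β _ => e1 β, Finset.sum_add_distrib,
      Finset.sum_range fun β : ℕ => 1 / (N : ℝ) * splineJump N 1 q d p (β + 1)
            * φ (1 / (N : ℝ) * (β + 1 : ℕ)),
      Fin.sum_univ_eq_sum_range (fun β : ℕ => if β = N - 1 then
        1 / (N : ℝ) * splineSeq N 1 q d p N 1 * φ 1 else 0) N, Finset.sum_ite_eq' ,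
      if_pos (Finset.mem_range.mpr (by omega))]
    ring
  rw [Formula.error, hsum]
  simp only [explicitFormula]
  rw [hA, hB]
  ring

theorem IsInnerRoots.isOptimal_explicitFormula (hq : IsInnerRoots m q) (hm : 2 ≤ m) (hN : 1 ≤ N)
    {d p : Fin (m - 1) → ℝ} (h : IsSolution m N q d p) :
    (explicitFormula m N q d p).IsOptimal m ∧
      ∀ Q' : Formula N, Q'.IsOptimal m → Q' = explicitFormula m N q d p := by
  have hN' : (N : ℝ) ≠ 0 := by positivity
  obtain ⟨hlow, ht0, ht1⟩ := (hq.isSolution_iff hm).mp h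
  have hB : (bernoulli (2 * m - 2 + 1) : ℝ) = 0 := by
    have : _root_.bernoulli (2 * m - 2 + 1) = 0 :=
      bernoulli_eq_zero_of_odd ⟨m - 1, by omega⟩ (by omega)
    exact_mod_cast this
  have hderiv : ∀ β ≤ N, expWeight N q d p β (2 * m - 2) = 0 →
      derivWithin (spline m N 1 q d p) (Icc 0 1) (1 / (N : ℝ) * β) = 0 := by
    intro β hβ hw
    have h2 := hq.iteratedDerivWithin_spline_eq hm hN 1 d p (n := 2 * m - 2 + 1) (by omega)
      (by omega) hβ
    rw [show 2 * m - (2 * m - 2 + 1) = 1 by omega, iteratedDerivWithin_one, splineSeq, hw, hB] at h2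
    rw [h2]
    simp
  refine Formula.isOptimal_of_representer (m := m) (ψ := spline m N 1 q d p) (s := (-1) ^ m)
    (by omega) hN (by rw [← mul_pow]; simp) (contDiff_spline hm 1 d p) ?_
    (fun β => hq.spline_node hm hN 1 d p (Nat.lt_succ_iff.mp β.2)) ?_ ?_ ?_
  · -- The derivative of order `2m` of the spline is `1`, so its norm is not zero.
    refine lt_of_le_of_ne (sobolevNorm_nonneg _) fun h0 => ?_
    have h1 := hq.iterate_derivative_splinePoly_eq_zero hm hN 1 d p (by
      rw [← sobolevNorm_sq, ← h0]; ring) (β := 0) (by omega)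
    have h2 := iterate_derivative_splinePoly_top m 1 q d p (by omega) hN 0
    rw [two_mul, Function.iterate_add_apply, h1, iterate_derivative_zero] at h2
    have := congrArg (eval 0) h2
    simp at this
  · have := hderiv 0 (Nat.zero_le _) ht0
    rwa [Nat.cast_zero, mul_zero] at this
  · have := hderiv N le_rfl ht1
    rwa [show 1 / (N : ℝ) * (N : ℝ) = 1 by field_simp] at this
  · intro φ hφ
    have hseq : ∀ j ∈ Finset.range (m - 2), (-1 : ℝ) ^ (j + 2 + 1)
        * ((1 / (N : ℝ)) ^ (j + 2 + 1) / (j + 2 + 1).factorial)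
          * (splineSeq N 1 q d p N (j + 2 + 1) * iteratedDerivWithin (j + 2) φ (Icc 0 1) 1
          - splineSeq N 1 q d p 0 (j + 2 + 1) * iteratedDerivWithin (j + 2) φ (Icc 0 1) 0) = 0 := by
      intro j hj
      have hj := Finset.mem_range.mp hj
      obtain ⟨e0, e1⟩ := hlow (j + 2) (by omega) (by omega)
      have hz : ((j + 2 : ℕ) : ℝ) + 1 ≠ 0 := by positivity
      rw [splineSeq, splineSeq, e0, e1, mul_div_cancel₀ _ hz]
      ring
    rw [hq.green hm hN 1 d p hφ, hq.error_explicitFormula hN d p φ,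
      show Finset.range m = Finset.range (m - 2 + 1 + 1) by congr 1; omega,
      Finset.sum_range_succ', Finset.sum_range_succ', Finset.sum_eq_zero hseq,
      iteratedDerivWithin_zero, show (0 : ℕ) + 1 = 1 from rfl, iteratedDerivWithin_one]
    norm_num [Nat.factorial]
    ring

end

/-! ### Solvability of the system -/

section

variable {m N : ℕ} {q : Fin (m - 1) → ℝ}

theorem expWeight_add (d p d' p' : Fin (m - 1) → ℝ) (β n : ℕ) :
    expWeight N q (d + d') (p + p') β n = expWeight N q d p β n + expWeight N q d' p' β n := by
  simp only [expWeight, ← Finset.sum_add_distrib, Pi.add_apply]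
  exact Finset.sum_congr rfl fun _ _ => by ring

theorem expWeight_smul (c : ℝ) (d p : Fin (m - 1) → ℝ) (β n : ℕ) :
    expWeight N q (c • d) (c • p) β n = c * expWeight N q d p β n := by
  simp only [expWeight, Finset.mul_sum, Pi.smul_apply, smul_eq_mul]
  exact Finset.sum_congr rfl fun _ _ => by ring

/-- The Taylor data of orders `σ i` at both end points, as a function of the weights `(d, p)`. -/
def dataMap (N : ℕ) (q : Fin (m - 1) → ℝ) (σ : Fin (m - 1) → ℕ) :
    ((Fin (m - 1) → ℝ) × (Fin (m - 1) → ℝ)) →ₗ[ℝ] (Fin (m - 1) → ℝ) × (Fin (m - 1) → ℝ) where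
  toFun x := (fun i => expWeight N q x.1 x.2 0 (σ i), fun i => expWeight N q x.1 x.2 N (σ i))
  map_add' x y := by
    refine Prod.ext (funext fun i => ?_) (funext fun i => ?_) <;>
    exact expWeight_add _ _ _ _ _ _
  map_smul' c x := by
    refine Prod.ext (funext fun i => ?_) (funext fun i => ?_) <;>
    exact expWeight_smul _ _ _ _ _

/-- The orders of the Taylor data prescribed by the system. -/
def systemOrder (i : Fin (m - 1)) : ℕ := if (i : ℕ) = 0 then 2 * m - 2 else (i : ℕ) + 1

/-- The right-hand side of the system, on one side. -/
def systemRhs (i : Fin (m - 1)) : ℝ :=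
  if (i : ℕ) = 0 then 0 else (bernoulli ((i : ℕ) + 2) : ℝ) / (((i : ℕ) : ℝ) + 2)

theorem IsInnerRoots.isSolution_iff_dataMap (hq : IsInnerRoots m q) (hm : 2 ≤ m)
    (x : (Fin (m - 1) → ℝ) × (Fin (m - 1) → ℝ)) :
    IsSolution m N q x.1 x.2 ↔ dataMap N q systemOrder x = (systemRhs, systemRhs) := by
  rw [hq.isSolution_iff hm]
  constructor
  · rintro ⟨h, h0, h1⟩
    refine Prod.ext (funext fun i => ?_) (funext fun i => ?_)
    · by_cases hi : (i : ℕ) = 0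
      · simp only [dataMap, LinearMap.coe_mk, AddHom.coe_mk, systemOrder, systemRhs, if_pos hi, h0]
      · simp only [dataMap, LinearMap.coe_mk, AddHom.coe_mk, systemOrder, systemRhs, if_neg hi]
        rw [(h ((i : ℕ) + 1) (by omega) (by omega)).1]
        push_cast
        ring
    · by_cases hi : (i : ℕ) = 0
      · simp only [dataMap, LinearMap.coe_mk, AddHom.coe_mk, systemOrder, systemRhs, if_pos hi, h1]
      · simp only [dataMap, LinearMap.coe_mk, AddHom.coe_mk, systemOrder, systemRhs, if_neg hi]
        rw [(h ((i : ℕ) + 1) (by omega) (by omega)).2]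
        push_cast
        ring
  · intro h
    have h0 : ∀ i : Fin (m - 1), expWeight N q x.1 x.2 0 (systemOrder i) = systemRhs i :=
      fun i => congrFun (congrArg Prod.fst h) i
    have h1 : ∀ i : Fin (m - 1), expWeight N q x.1 x.2 N (systemOrder i) = systemRhs i :=
      fun i => congrFun (congrArg Prod.snd h) i
    refine ⟨fun j h2 hj => ?_, ?_, ?_⟩
    · have e0 := h0 ⟨j - 1, by omega⟩
      have e1 := h1 ⟨j - 1, by omega⟩
      simp only [systemOrder, systemRhs] at e0 e1
      rw [if_neg (by omega), if_neg (by omega)] at e0 e1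
      obtain ⟨l, rfl⟩ : ∃ l, j = l + 1 := ⟨j - 1, by omega⟩
      rw [Nat.add_sub_cancel] at e0 e1
      rw [e0, e1]
      push_cast
      constructor <;> ring
    · simpa [systemOrder, systemRhs] using h0 ⟨0, by omega⟩
    · simpa [systemOrder, systemRhs] using h1 ⟨0, by omega⟩

theorem expWeight_eq_zero_of_splinePoly (hN : 1 ≤ N)
    {d p : Fin (m - 1) → ℝ} {l : ℕ} (hl : l + 1 < 2 * m)
    (h : derivative^[2 * m - (l + 1)] (splinePoly m N 0 q d p 0) = 0) :
    expWeight N q d p 0 l = 0 := by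
  have hN' : (0 : ℝ) < N := by exact_mod_cast hN
  have h1 := eval_iterate_derivative_splinePoly m 0 q d p hN 0 hl
  rw [h, eval_zero, splineSeq] at h1
  have h2 : (1 / (N : ℝ)) ^ (l + 1) ≠ 0 := by positivity
  have h3 : ((l + 1).factorial : ℝ) ≠ 0 := Nat.cast_ne_zero.mpr (Nat.factorial_ne_zero _)
  have h4 : (l : ℝ) + 1 ≠ 0 := by positivity
  have h5 := (div_eq_zero_iff.mp h1.symm).resolve_right h3
  have h6 := (mul_eq_zero.mp h5).resolve_left h2
  rw [zero_mul, zero_sub, neg_eq_zero] at h6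
  exact (mul_eq_zero.mp h6).resolve_left h4

theorem IsInnerRoots.expWeight_eq_zero_of_inner (hq : IsInnerRoots m q) (hm : 2 ≤ m) (hN : 1 ≤ N)
    {d p : Fin (m - 1) → ℝ}
    (h : sobolevInner m (spline m N 0 q d p) (spline m N 0 q d p) = 0) {l : ℕ} (hl : l ≤ m - 1) :
    expWeight N q d p 0 l = 0 := by
  refine expWeight_eq_zero_of_splinePoly hN (by omega) ?_
  rw [show 2 * m - (l + 1) = (m - (l + 1)) + m by omega, Function.iterate_add_apply,
    hq.iterate_derivative_splinePoly_eq_zero hm hN 0 d p h (by omega), iterate_derivative_zero]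

/-- A null spline whose derivatives of order `1, …, m - 1` vanish at both end points vanishes. -/
theorem IsInnerRoots.dataMap_clamped_surjective (hq : IsInnerRoots m q) (hm : 2 ≤ m) (hN : 1 ≤ N) :
    Function.Surjective (dataMap N q fun i => 2 * m - 2 - (i : ℕ)) := by
  rw [← LinearMap.injective_iff_surjective, injective_iff_map_eq_zero]
  intro x hx
  have h0 : ∀ i < m - 1, expWeight N q x.1 x.2 0 (2 * m - 2 - i) = 0 :=
    fun i hi => congrFun (congrArg Prod.fst hx) ⟨i, hi⟩
  have h1 : ∀ i < m - 1, expWeight N q x.1 x.2 N (2 * m - 2 - i) = 0 :=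
    fun i hi => congrFun (congrArg Prod.snd hx) ⟨i, hi⟩
  have hg := hq.green_spline hm hN 0 x.1 x.2 x.1 x.2
  rw [Finset.sum_eq_zero, zero_mul, zero_add] at hg
  · have hin := (mul_eq_zero.mp hg).resolve_left (by simp)
    have := hq.eq_zero_of_expWeight (N := N) (d := x.1) (p := x.2) fun n hn => by
      rcases Nat.lt_or_ge (m - 1) n with h | h
      · have := h0 (2 * m - 2 - n) (by omega)
        rwa [show 2 * m - 2 - (2 * m - 2 - n) = n by omega] at this
      · exact hq.expWeight_eq_zero_of_inner hm hN hin h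
    exact Prod.ext this.1 this.2
  · intro i hi
    have hi := Finset.mem_range.mp hi
    rw [h0 i hi, h1 i hi, mul_zero, mul_zero, sub_zero, mul_zero]

/-- A null spline of norm zero whose derivative vanishes at the end points is a polynomial of
degree less than `m` with simple zeros at the nodes and double zeros at the end points. -/
theorem IsInnerRoots.polynomial_of_inner (hq : IsInnerRoots m q) (hm : 2 ≤ m) (hN : 1 ≤ N)
    {d p : Fin (m - 1) → ℝ}
    (h : sobolevInner m (spline m N 0 q d p) (spline m N 0 q d p) = 0)
    (h0 : expWeight N q d p 0 (2 * m - 2) = 0) (h1 : expWeight N q d p N (2 * m - 2) = 0) :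
    derivative^[m] (splinePoly m N 0 q d p 0) = 0 ∧
    (∀ β ≤ N, (splinePoly m N 0 q d p 0).eval (1 / (N : ℝ) * β) = 0) ∧
    (derivative (splinePoly m N 0 q d p 0)).eval 0 = 0 ∧
    (derivative (splinePoly m N 0 q d p 0)).eval 1 = 0 := by
  have hN' : (N : ℝ) ≠ 0 := by positivity
  have hfun := hq.spline_eq_polynomial hm hN 0 d p h
  have hd : ∀ β ≤ N, expWeight N q d p β (2 * m - 2) = 0 →
      (derivative (splinePoly m N 0 q d p 0)).eval (1 / (N : ℝ) * β) = 0 := by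
    intro β hβ hw
    have h2 := hq.iteratedDerivWithin_spline_eq hm hN 0 d p (n := 2 * m - 2 + 1) (by omega)
      (by omega) hβ
    rw [show 2 * m - (2 * m - 2 + 1) = 1 by omega, iteratedDerivWithin_one, splineSeq, hw, hfun,
      ((splinePoly m N 0 q d p 0).hasDerivAt _).hasDerivWithinAt.derivWithin
        (uniqueDiffOn_unit _ (node_mem_unit hN hβ))] at h2
    rw [h2]
    simp
  refine ⟨hq.iterate_derivative_splinePoly_eq_zero hm hN 0 d p h (by omega), fun β hβ => ?_, ?_, ?_⟩
  · have := hq.spline_node hm hN 0 d p hβ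
    rwa [hfun] at this
  · have := hd 0 (Nat.zero_le _) h0
    rwa [Nat.cast_zero, mul_zero] at this
  · have := hd N le_rfl h1
    rwa [show 1 / (N : ℝ) * (N : ℝ) = 1 by field_simp] at this

theorem IsInnerRoots.solution_unique (hq : IsInnerRoots m q) (hm : 2 ≤ m) (hN : 1 ≤ N)
    (hmN : m ≤ N + 3) {x y : (Fin (m - 1) → ℝ) × (Fin (m - 1) → ℝ)}
    (hx : IsSolution m N q x.1 x.2) (hy : IsSolution m N q y.1 y.2) : x = y := by
  rw [hq.isSolution_iff_dataMap hm] at hx hy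
  rw [← sub_eq_zero]
  set z := x - y with hz
  have hzd : dataMap N q systemOrder z = 0 := by rw [hz, map_sub, hx, hy, sub_self]
  have h0 : ∀ i : Fin (m - 1), expWeight N q z.1 z.2 0 (systemOrder i) = 0 :=
    fun i => congrFun (congrArg Prod.fst hzd) i
  have h1 : ∀ i : Fin (m - 1), expWeight N q z.1 z.2 N (systemOrder i) = 0 :=
    fun i => congrFun (congrArg Prod.snd hzd) i
  have ht0 : expWeight N q z.1 z.2 0 (2 * m - 2) = 0 := by
    simpa [systemOrder] using h0 ⟨0, by omega⟩
  have ht1 : expWeight N q z.1 z.2 N (2 * m - 2) = 0 := by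
    simpa [systemOrder] using h1 ⟨0, by omega⟩
  have hg := hq.green_spline hm hN 0 z.1 z.2 z.1 z.2
  rw [Finset.sum_eq_zero, zero_mul, zero_add] at hg
  · have hin := (mul_eq_zero.mp hg).resolve_left (by simp)
    obtain ⟨hP, hn, hd0, hd1⟩ := hq.polynomial_of_inner hm hN hin ht0 ht1
    have hP0 := eq_zero_of_nodes (by omega) hN hmN hP hn hd0 hd1
    have := hq.eq_zero_of_expWeight (N := N) (d := z.1) (p := z.2) fun n hn =>
      expWeight_eq_zero_of_splinePoly hN (by omega)
        (by rw [hP0, iterate_derivative_zero])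
    exact Prod.ext this.1 this.2
  · intro i hi
    have hi := Finset.mem_range.mp hi
    by_cases hi0 : i = 0
    · subst hi0
      simp [ht0, ht1]
    · have e0 := h0 ⟨i, hi⟩
      have e1 := h1 ⟨i, hi⟩
      simp only [systemOrder, if_neg hi0] at e0 e1
      rw [e0, e1]
      simp

/-- The Fredholm alternative. A linear functional that annihilates the range of the system is
represented, through Green's formula, by a null spline; this spline has norm zero, so it is a
polynomial of degree less than `m` on which every formula vanishes, and the functional takes the
value `± ∫ P = 0` on the right-hand side. -/
theorem IsInnerRoots.exists_solution (hq : IsInnerRoots m q) (hm : 2 ≤ m) (hN : 1 ≤ N)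
    (hadm : ∀ P : ℝ[X], derivative^[m] P = 0 → (∀ β ≤ N, P.eval (1 / (N : ℝ) * β) = 0) →
      (derivative P).eval 0 = 0 → (derivative P).eval 1 = 0 → ∫ x in (0 : ℝ)..1, P.eval x = 0) :
    ∃ d p : Fin (m - 1) → ℝ, IsSolution m N q d p := by
  by_contra! hcon
  have hnot : ((systemRhs, systemRhs) : (Fin (m - 1) → ℝ) × (Fin (m - 1) → ℝ))
      ∉ LinearMap.range (dataMap N q systemOrder) := by
    rintro ⟨x, hx⟩
    exact hcon x.1 x.2 ((hq.isSolution_iff_dataMap hm x).mpr hx)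
  obtain ⟨f, hfr, hf⟩ := Submodule.exists_le_ker_of_notMem hnot
  set a : Fin (m - 1) → ℝ := fun i => f (Pi.single i 1, 0) with ha
  set b : Fin (m - 1) → ℝ := fun i => f (0, Pi.single i 1) with hb
  have hfab : ∀ v w : Fin (m - 1) → ℝ, f (v, w) = ∑ i, (v i * a i + w i * b i) := by
    intro v w
    have e1 : f (v, w) = (f ∘ₗ LinearMap.inl ℝ _ _) v + (f ∘ₗ LinearMap.inr ℝ _ _) w := by
      simp [← map_add]
    rw [e1, LinearMap.pi_apply_eq_sum_univ (f ∘ₗ LinearMap.inl ℝ _ _) v,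
      LinearMap.pi_apply_eq_sum_univ (f ∘ₗ LinearMap.inr ℝ _ _) w, ← Finset.sum_add_distrib]
    refine Finset.sum_congr rfl fun i _ => ?_
    have hs : (fun j => if i = j then (1 : ℝ) else 0) = Pi.single i 1 := by
      funext j
      by_cases h : i = j
      · subst h; simp
      · simp [h, Ne.symm h]
    rw [hs]
    rfl
  have hfx : ∀ x, f (dataMap N q systemOrder x) = 0 := fun x =>
    LinearMap.mem_ker.mp (hf (LinearMap.mem_range_self _ x))
  -- The null spline `y` represents the functional in Green's formula.
  obtain ⟨y, hy⟩ := hq.dataMap_clamped_surjective hm hN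
    (fun i => if (i : ℕ) = 0 then 0 else -((-1) ^ (i : ℕ) * a i / greenCoeff m N i),
      fun i => if (i : ℕ) = 0 then 0 else (-1) ^ (i : ℕ) * b i / greenCoeff m N i)
  have hy0 : ∀ i : Fin (m - 1), expWeight N q y.1 y.2 0 (2 * m - 2 - i)
      = if (i : ℕ) = 0 then 0 else -((-1) ^ (i : ℕ) * a i / greenCoeff m N i) :=
    fun i => congrFun (congrArg Prod.fst hy) i
  have hy1 : ∀ i : Fin (m - 1), expWeight N q y.1 y.2 N (2 * m - 2 - i)
      = if (i : ℕ) = 0 then 0 else (-1) ^ (i : ℕ) * b i / greenCoeff m N i :=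
    fun i => congrFun (congrArg Prod.snd hy) i
  have ht0 : expWeight N q y.1 y.2 0 (2 * m - 2) = 0 := by simpa using hy0 ⟨0, by omega⟩
  have ht1 : expWeight N q y.1 y.2 N (2 * m - 2) = 0 := by simpa using hy1 ⟨0, by omega⟩
  have hpair : ∀ (κ : ℝ) (x : (Fin (m - 1) → ℝ) × (Fin (m - 1) → ℝ)),
      (-1) ^ m * sobolevInner m (spline m N κ q x.1 x.2) (spline m N 0 q y.1 y.2)
      = κ * (∫ x in (0 : ℝ)..1, spline m N 0 q y.1 y.2 x)
        + ∑ i : Fin (m - 1), if (i : ℕ) = 0 then 0 else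
          ((expWeight N q x.1 x.2 0 (systemOrder i) - κ * systemRhs i) * a i
            + (expWeight N q x.1 x.2 N (systemOrder i) - κ * systemRhs i) * b i) := by
    intro κ x
    rw [hq.green_spline hm hN κ x.1 x.2 y.1 y.2, Finset.sum_range]
    congr 1
    refine Finset.sum_congr rfl fun i _ => ?_
    rw [hy0 i, hy1 i]
    by_cases hi : (i : ℕ) = 0
    · simp [hi]
    · simp only [if_neg hi, systemOrder, systemRhs]
      have hc := greenCoeff_ne_zero (m := m) hN (i : ℕ)
      have hs : ((-1 : ℝ) ^ (i : ℕ)) * (-1) ^ (i : ℕ) = 1 := by rw [← mul_pow]; simp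
      generalize ((-1 : ℝ) ^ (i : ℕ)) = s at hs ⊢
      rw [mul_div_assoc κ]
      generalize expWeight N q x.1 x.2 N ((i : ℕ) + 1)
        - κ * ((bernoulli ((i : ℕ) + 2) : ℝ) / (((i : ℕ) : ℝ) + 2)) = u1
      generalize expWeight N q x.1 x.2 0 ((i : ℕ) + 1)
        - κ * ((bernoulli ((i : ℕ) + 2) : ℝ) / (((i : ℕ) : ℝ) + 2)) = u0
      field_simp
      linear_combination (u1 * b i + u0 * a i) * hs
  have hin : sobolevInner m (spline m N 0 q y.1 y.2) (spline m N 0 q y.1 y.2) = 0 := by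
    have h1 := hpair 0 y
    have h2 := hfx y
    rw [show dataMap N q systemOrder y = (fun i => expWeight N q y.1 y.2 0 (systemOrder i),
      fun i => expWeight N q y.1 y.2 N (systemOrder i)) from rfl, hfab] at h2
    rw [zero_mul, zero_add] at h1
    have h3 : ∀ i : Fin (m - 1), (if (i : ℕ) = 0 then 0 else
          ((expWeight N q y.1 y.2 0 (systemOrder i) - 0 * systemRhs i) * a i
            + (expWeight N q y.1 y.2 N (systemOrder i) - 0 * systemRhs i) * b i))
        = expWeight N q y.1 y.2 0 (systemOrder i) * a i
          + expWeight N q y.1 y.2 N (systemOrder i) * b i := by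
      intro i
      by_cases hi : (i : ℕ) = 0
      · simp [hi, systemOrder, ht0, ht1]
      · simp [hi]
    rw [Finset.sum_congr rfl fun i _ => h3 i, h2] at h1
    exact (mul_eq_zero.mp h1).resolve_left (by simp)
  obtain ⟨hP, hn, hd0, hd1⟩ := hq.polynomial_of_inner hm hN hin ht0 ht1
  have hint : ∫ x in (0 : ℝ)..1, spline m N 0 q y.1 y.2 x = 0 := by
    rw [hq.spline_eq_polynomial hm hN 0 y.1 y.2 hin]
    exact hadm _ hP hn hd0 hd1
  have hzero : sobolevInner m (spline m N 1 q 0 0) (spline m N 0 q y.1 y.2) = 0 := by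
    have h1 := abs_integral_mul_le (isSobolev_spline (N := N) (q := q) hm 0 y.1 y.2)
      (isSobolev_spline (N := N) (q := q) hm 1 0 0)
    have h2 : sobolevNorm m (spline m N 0 q y.1 y.2) = 0 := by
      have := sobolevNorm_sq (m := m) (spline m N 0 q y.1 y.2)
      rw [hin] at this
      exact pow_eq_zero_iff two_ne_zero |>.mp this
    rw [h2, mul_zero] at h1
    exact abs_eq_zero.mp (le_antisymm h1 (abs_nonneg _))
  -- Pair the Bernoulli monospline with `y`.
  have h1 := hpair 1 0
  simp only [Prod.fst_zero, Prod.snd_zero] at h1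
  have hw : ∀ β n, expWeight N q 0 0 β n = 0 := fun β n => by simp [expWeight]
  simp only [hw, hzero, hint, mul_zero, zero_add, zero_sub, one_mul] at h1
  apply hfr
  rw [hfab, ← neg_eq_zero, ← Finset.sum_neg_distrib, h1]
  refine Finset.sum_congr rfl fun i _ => ?_
  by_cases hi : (i : ℕ) = 0
  · simp [hi, systemRhs]
  · rw [if_neg hi]; ring

/-- A polynomial on which all formulas vanish has integral zero as soon as some formula has a
bounded error functional. -/
theorem integral_eq_zero_of_admissible (hm : 2 ≤ m) (hN : 1 ≤ N)
    (hadm : m ≤ N + 3 ∨ ∃ Q : Formula N, Q.errorNorm m ≠ ⊤) {P : ℝ[X]}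
    (hP : derivative^[m] P = 0) (hn : ∀ β ≤ N, P.eval (1 / (N : ℝ) * β) = 0)
    (h0 : (derivative P).eval 0 = 0) (h1 : (derivative P).eval 1 = 0) :
    ∫ x in (0 : ℝ)..1, P.eval x = 0 := by
  rcases hadm with hmN | ⟨Q, hQ⟩
  · rw [eq_zero_of_nodes (by omega) hN hmN hP hn h0 h1]
    simp
  · have hle : Q.errorNorm m ≤ ENNReal.ofReal (Q.errorNorm m).toReal :=
      (ENNReal.ofReal_toReal hQ).ge
    have h2 := Formula.abs_error_le (by omega) ENNReal.toReal_nonneg hle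
      (contDiff_polynomial P (n := m))
    have h3 : sobolevNorm m (fun x => P.eval x) = 0 := by
      rw [sobolevNorm, intervalIntegral.integral_congr (g := fun _ => (0 : ℝ))]
      · simp
      · intro x hx
        rw [uIcc_of_le zero_le_one] at hx
        simp only [iteratedDerivWithin_of_contDiff (contDiff_polynomial P (n := m)) le_rfl hx,
          iteratedDeriv_polynomial, hP, eval_zero]
        norm_num
    rw [h3, mul_zero, Q.error_polynomial, h0, h1, Finset.sum_eq_zero] at h2
    · simpa using h2
    · intro β _
      rw [hn β (Nat.lt_succ_iff.mp β.2), mul_zero]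

end

end OptQuad

end

theorem theorem5p1 (m N : ℕ) (hm : 2 ≤ m) (hN : 1 ≤ N)
    (hadm : m ≤ N + 3 ∨ ∃ Q : OptQuad.Formula N, Q.errorNorm m ≠ ⊤) :
    (∃! Q : OptQuad.Formula N, Q.IsOptimal m) ∧
    (∃ q : Fin (m - 1) → ℝ, OptQuad.IsInnerRoots m q) ∧
    ∀ q : Fin (m - 1) → ℝ, OptQuad.IsInnerRoots m q →
      (∃ d p : Fin (m - 1) → ℝ, OptQuad.IsSolution m N q d p) ∧
      (∀ d p : Fin (m - 1) → ℝ, OptQuad.IsSolution m N q d p →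
        (OptQuad.explicitFormula m N q d p).IsOptimal m) ∧
      (m ≤ N + 3 → ∃! dp : (Fin (m - 1) → ℝ) × (Fin (m - 1) → ℝ),
        OptQuad.IsSolution m N q dp.1 dp.2) := by
  have hex : ∀ q : Fin (m - 1) → ℝ, OptQuad.IsInnerRoots m q →
      ∃ d p : Fin (m - 1) → ℝ, OptQuad.IsSolution m N q d p := fun q hq =>
    hq.exists_solution hm hN fun _ hP hn h0 h1 =>
      OptQuad.integral_eq_zero_of_admissible hm hN hadm hP hn h0 h1
  obtain ⟨q, hq⟩ := OptQuad.exists_isInnerRoots m hm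
  refine ⟨?_, ⟨q, hq⟩, fun q hq => ⟨hex q hq, fun d p h =>
    (hq.isOptimal_explicitFormula hm hN h).1, fun hmN => ?_⟩⟩
  · obtain ⟨d, p, h⟩ := hex q hq
    obtain ⟨h1, h2⟩ := hq.isOptimal_explicitFormula hm hN h
    exact ⟨_, h1, h2⟩
  · obtain ⟨d, p, h⟩ := hex q hq
    exact ⟨(d, p), h, fun y hy => hq.solution_unique hm hN hmN hy h⟩
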